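/- For a finite simple graph $H$ let $\sigma_2(H)$ be the minimum of $d_H(x)+d_H(y)$ over all pairs of distinct non-adjacent vertices $x,y$ of $H$ (with $\sigma_2(H)=\infty$ if $H$ is complete). Let $G=(G_1,\dots,G_n)$ be a collection of $n$ (not necessarily distinct) simple graphs on a common vertex set $V$ with $|V|=n$. A Hamiltonian $u,v$-path is a path from $u$ to $v$ through all vertices of $V$; it is rainbow in $G$ if there is an injection $c$ from its edge set to $\{1,\dots,n\}$ such that $e\in E(G_{c(e)})$ for each of its edges $e$. Suppose that $\sigma_2(G_i)\ge n$ for all $i\in\{1,\dots,n\}$. Then for every pair of distinct vertices $u,v\in V$, at least one of the following holds: (B1) $G$ contains a rainbow Hamiltonian $u,v$-path; (B2) there is a partition $V\setminus\{u,v\}=X\cup Y$ with $|X|,|Y|\ge 1$ such that for every $i\in\{1,\dots,n\}$, in $G_i$ the sets $X$ and $Y$ are cliques with no edges between them, and $u$ and $v$ are both adjacent to every vertex of $X\cup Y$; (B3) $n$ is even and there is a partition $V=X\cup Y$ with $|X|=|Y|=n/2$ and $u,v\in X$ such that for every $i\in\{1,\dots,n\}$ the bipartite graph $G_i[X,Y]$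 is complete, i.e. every vertex of $X$ is adjacent in $G_i$ to every vertex of $Y$. -/

import Mathlib

/-- `σ₂(G)`: the minimum of `d_G(x) + d_G(y)` over all pairs of distinct non-adjacent vertices,
with the usual convention that it is `∞` when `G` is complete. -/
noncomputable def SimpleGraph.sigmaTwo {V : Type*} [Fintype V] (G : SimpleGraph V)
    [DecidableRel G.Adj] : ℕ∞ :=
  ⨅ (x : V) (y : V) (_ : x ≠ y ∧ ¬ G.Adj x y), ((G.degree x + G.degree y : ℕ) : ℕ∞)

/-- The collection `G` contains a rainbow `H`, for a graph `H` whose vertices lie in `V`: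
there is an injective assignment of colors to the edges of `H` such that every
edge of `H` is an edge of the graph of its color. -/
def ContainsRainbow {V ι : Type*} (G : ι → SimpleGraph V)
    (H : (⊤ : SimpleGraph V).Subgraph) : Prop :=
  ∃ c : H.edgeSet → ι, Function.Injective c ∧
    ∀ e : H.edgeSet, (e : Sym2 V) ∈ (G (c e)).edgeSet

/-- The collection `G` contains a rainbow Hamiltonian `u,v`-path: a path from `u` to `v` on the
vertex set `V` (not required to lie in any single `G i`) through every vertex, which is rainbow. -/
def HasRainbowHamiltonianPath {V ι : Type*} [DecidableEq V] (G : ι → SimpleGraph V)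
    (u v : V) : Prop :=
  ∃ p : (⊤ : SimpleGraph V).Walk u v, p.IsHamiltonian ∧ ContainsRainbow G p.toSubgraph

/-! Enlarge the collection to a maximal one without a rainbow Hamiltonian `u,v`-path. Ore's
condition survives, and non-edges found there are non-edges of the original graphs. Adding a missing
edge `xy` in color `i` creates such a path, so disjoint rainbow paths from `x` to `u` and from `y`
to `v` cover `V`, leaving `i` and one more color `s` unused. Rotations exclude certain pairs of
edges at `x` and `y` in colors `i` and `s`; this bounds the sum of the four degrees by `2n`, which
is what Ore's condition demands. Hence every exclusion is sharp (`SplitPath.adj_dichotomy`), and it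
follows that `u` and `v` are adjacent to everything in every color.

Deleting `u` and `v` leaves two rainbow paths `P`, `Q` and four free colors: two to reattach `u` and
`v` at any ends, two to which the dichotomy applies. So for heads `x`, `y` and consecutive `p`, `q`
on `P`, in free colors `x ~ q` iff not `y ~ p` (`TwoPathCover.adj_iff`).

If no end of a path is ever joined in a free color to the other path, a path with an edge closes to
a cycle. Cutting the cycle elsewhere turns any vertex into an end and any color into a free one, so
no edge joins `P` and `Q` (`TwoPathCover.not_adj`): this leads to (B2). Otherwise the neighborhood
of an end alternates along both paths, and the vertices outside it form an independent set of size
`n/2` in all colors (`AlternatingCover.exists_independent`): this leads to (B3). In both cases the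
degree bounds in the original graphs are tight and supply the required adjacencies. -/

/-! ### Rainbow paths as lists of vertices -/

/-- `RainbowList G l C`: consecutive vertices of the list `l` are joined by edges whose colors
form exactly the multiset `C`. -/
inductive RainbowList {V ι : Type*} (G : ι → SimpleGraph V) : List V → Multiset ι → Prop
  | single (a : V) : RainbowList G [a] 0
  | cons {a b : V} {l : List V} {c : ι} {C : Multiset ι} :
      (G c).Adj a b → RainbowList G (b :: l) C → RainbowList G (a :: b :: l) (c ::ₘ C)

namespace RainbowList

variable {V ι : Type*} {G : ι → SimpleGraph V}

theorem ne_nil {l : List V} {C : Multiset ι} (h : RainbowList G l C) : l ≠ [] := by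
  cases h <;> simp

theorem card {l : List V} {C : Multiset ι} (h : RainbowList G l C) :
    Multiset.card C + 1 = l.length := by
  induction h with
  | single a => simp
  | cons _ _ ih => simpa using ih

theorem append {l₁ l₂ : List V} {C₁ C₂ : Multiset ι} {p q : V} {c : ι}
    (h₁ : RainbowList G l₁ C₁) (h₂ : RainbowList G l₂ C₂) (hp : l₁.getLast? = some p)
    (hq : l₂.head? = some q) (hpq : (G c).Adj p q) :
    RainbowList G (l₁ ++ l₂) (c ::ₘ (C₁ + C₂)) := by
  induction h₁ with
  | single a =>
    cases l₂ with
    | nil => simp at hq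
    | cons b l =>
      simp only [List.head?_cons, Option.some.injEq, List.getLast?_singleton] at hp hq
      subst hp hq
      simpa using cons hpq h₂
  | cons hab _ ih =>
    rw [List.getLast?_cons_cons] at hp
    have := cons hab (ih hp)
    rwa [Multiset.cons_swap, ← Multiset.cons_add] at this

theorem split {l₁ l₂ : List V} {C : Multiset ι} {p q : V}
    (h : RainbowList G (l₁ ++ p :: q :: l₂) C) :
    ∃ c C₁ C₂, C = c ::ₘ (C₁ + C₂) ∧ (G c).Adj p q ∧ RainbowList G (l₁ ++ [p]) C₁ ∧
      RainbowList G (q :: l₂) C₂ := by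
  induction l₁ generalizing C with
  | nil =>
    cases h with
    | cons hab h => exact ⟨_, 0, _, by simp, hab, single _, h⟩
  | cons a l ih =>
    cases l with
    | nil =>
      cases h with
      | cons hab h =>
        obtain ⟨c, C₁, C₂, rfl, hpq, h₁, h₂⟩ := ih h
        exact ⟨c, _ ::ₘ C₁, C₂, by rw [Multiset.cons_swap, Multiset.cons_add], hpq,
          cons hab h₁, h₂⟩
    | cons b l =>
      cases h with
      | cons hab h =>
        obtain ⟨c, C₁, C₂, rfl, hpq, h₁, h₂⟩ := ih h
        exact ⟨c, _ ::ₘ C₁, C₂, by rw [Multiset.cons_swap, Multiset.cons_add], hpq,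
          cons hab h₁, h₂⟩

theorem reverse {l : List V} {C : Multiset ι} (h : RainbowList G l C) :
    RainbowList G l.reverse C := by
  induction h with
  | single a => exact single a
  | @cons a b l c C hab _ ih =>
    have := ih.append (single a) (p := b) (by simp) rfl hab.symm
    simpa using this

theorem exists_edge_of_mem {l : List V} {C : Multiset ι} {c : ι} (h : RainbowList G l C)
    (hc : c ∈ C) : ∃ l₁ p q l₂ C₁ C₂, l = l₁ ++ p :: q :: l₂ ∧ C = c ::ₘ (C₁ + C₂) ∧
      (G c).Adj p q ∧ RainbowList G (l₁ ++ [p]) C₁ ∧ RainbowList G (q :: l₂) C₂ := by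
  induction h with
  | single a => simp at hc
  | @cons a b l d C hab h ih =>
    rcases Multiset.mem_cons.1 hc with rfl | hc
    · exact ⟨[], a, b, l, 0, C, rfl, by simp, hab, single a, h⟩
    · obtain ⟨l₁, p, q, l₂, C₁, C₂, hl, rfl, hpq, h₁, h₂⟩ := ih hc
      refine ⟨a :: l₁, p, q, l₂, d ::ₘ C₁, C₂, by simp [hl], ?_, hpq, ?_, h₂⟩
      · rw [Multiset.cons_swap, Multiset.cons_add]
      · cases l₁ with
        | nil =>
          simp only [List.nil_append, List.cons.injEq] at hl
          exact cons (hl.1 ▸ hab) h₁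
        | cons b' l₁ =>
          simp only [List.cons_append, List.cons.injEq] at hl
          exact cons (hl.1 ▸ hab) h₁

/-- In a collection of complete graphs every list without repetitions can be colored by
any multiset of the right size. -/
theorem of_complete (hG : ∀ i x y, x ≠ y → (G i).Adj x y) {l : List V} (hl : l.Nodup)
    {C : Multiset ι} (hC : Multiset.card C + 1 = l.length) : RainbowList G l C := by
  induction l generalizing C with
  | nil => simp at hC
  | cons a l ih =>
    cases l with
    | nil =>
      obtain rfl : C = 0 := by simpa using hC
      exact single a
    | cons b l =>
      obtain ⟨c, C, rfl⟩ := Multiset.card_pos_iff_exists_mem.1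
        (show 0 < Multiset.card C by simp at hC; omega) |>.imp
          fun c hc => Multiset.exists_cons_of_mem hc
      refine cons (hG _ _ _ ?_) (ih hl.of_cons (by simpa using hC))
      rintro rfl
      simp at hl

/-- A rainbow list in the collection with one edge `xy` added in color `i` either avoids the
new edge or splits at it into two rainbow lists of the original collection. -/
theorem of_adj_or {G' : ι → SimpleGraph V} {i : ι} {x y : V}
    (hG' : ∀ j a b, (G' j).Adj a b → (G j).Adj a b ∨ j = i ∧ (a = x ∧ b = y ∨ a = y ∧ b = x))
    {l : List V} {C : Multiset ι} (h : RainbowList G' l C) (hC : C.Nodup) :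
    RainbowList G l C ∨ ∃ l₁ p q l₂ C₁ C₂, l = l₁ ++ p :: q :: l₂ ∧ C = i ::ₘ (C₁ + C₂) ∧
      (p = x ∧ q = y ∨ p = y ∧ q = x) ∧ RainbowList G (l₁ ++ [p]) C₁ ∧
      RainbowList G (q :: l₂) C₂ := by
  induction h with
  | single a => exact .inl (single a)
  | @cons a b l d C hab h ih =>
    obtain ⟨hd, hC⟩ := Multiset.nodup_cons.1 hC
    rcases ih hC with h' | ⟨l₁, p, q, l₂, C₁, C₂, hl, rfl, hpq, h₁, h₂⟩
    · rcases hG' _ _ _ hab with hab | ⟨rfl, hab⟩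
      · exact .inl (cons hab h')
      · exact .inr ⟨[], a, b, l, 0, C, rfl, by simp, hab, single a, h'⟩
    · right
      -- The tail already uses color `i` and colors do not repeat, so the new edge occurs at most
      -- once.
      have hab : (G d).Adj a b := by
        rcases hG' _ _ _ hab with hab | ⟨rfl, hab⟩
        · exact hab
        · simp at hd
      refine ⟨a :: l₁, p, q, l₂, d ::ₘ C₁, C₂, by simp [hl], ?_, hpq, ?_, h₂⟩
      · rw [Multiset.cons_swap, Multiset.cons_add]
      · cases l₁ with
        | nil =>
          simp only [List.nil_append, List.cons.injEq] at hl
          exact cons (hl.1 ▸ hab) h₁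
        | cons b' l₁ =>
          simp only [List.cons_append, List.cons.injEq] at hl
          exact cons (hl.1 ▸ hab) h₁

end RainbowList

/-! ### From lists to Hamiltonian walks -/

/-- A rainbow Hamiltonian `u,v`-path, as a list of vertices. -/
def HasRainbowHamiltonianList {V ι : Type*} (G : ι → SimpleGraph V) (u v : V) : Prop :=
  ∃ l C, RainbowList G l C ∧ C.Nodup ∧ l.Nodup ∧ (∀ z, z ∈ l) ∧ l.head? = some u ∧
    l.getLast? = some v

theorem HasRainbowHamiltonianList.symm {V ι : Type*} {G : ι → SimpleGraph V} {u v : V}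
    (h : HasRainbowHamiltonianList G u v) : HasRainbowHamiltonianList G v u := by
  obtain ⟨l, C, h, hC, hl, hz, hu, hv⟩ := h
  exact ⟨l.reverse, C, h.reverse, hC, by simpa using hl, by simpa using hz, by simpa using hv,
    by simpa using hu⟩

theorem RainbowList.exists_walk {V ι : Type*} [Nonempty ι] {G : ι → SimpleGraph V}
    {l : List V} {C : Multiset ι} (h : RainbowList G l C) (hl : l.Nodup) {u v : V}
    (hu : l.head? = some u) (hv : l.getLast? = some v) :
    ∃ (p : (⊤ : SimpleGraph V).Walk u v) (c : Sym2 V → ι), p.support = l ∧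
      (∀ e ∈ p.edges, e ∈ (G (c e)).edgeSet) ∧ (p.edges.map c : Multiset ι) = C := by
  classical
  induction h generalizing u with
  | single a =>
    obtain rfl : a = u := by simpa using hu
    obtain rfl : a = v := by simpa using hv
    exact ⟨.nil, fun _ => Classical.arbitrary ι, by simp, by simp, by simp⟩
  | @cons a b l d C hab h ih =>
    obtain rfl : a = u := by simpa using hu
    obtain ⟨p, c, hs, hc, hC⟩ := ih hl.of_cons rfl (by simpa using hv)
    -- Since `a` is not revisited, recoloring `s(a, b)` leaves the colors of the tail intact.
    have hnew : s(a, b) ∉ p.edges := fun h => by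
      have := p.fst_mem_support_of_mem_edges h
      rw [hs] at this
      exact (List.nodup_cons.1 hl).1 this
    refine ⟨.cons ((SimpleGraph.top_adj _ _).2 hab.ne) p, Function.update c s(a, b) d, by simp [hs],
      ?_, ?_⟩
    · intro e he
      rw [SimpleGraph.Walk.edges_cons, List.mem_cons] at he
      rcases he with rfl | he
      · simpa using hab
      · rw [Function.update_of_ne (ne_of_mem_of_not_mem he hnew)]
        exact hc e he
    · rw [SimpleGraph.Walk.edges_cons, List.map_cons, Function.update_self, ← hC,
        ← Multiset.cons_coe]
      congr 2
      exact List.map_congr_left fun e he => Function.update_of_ne (ne_of_mem_of_not_mem he hnew) _ _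

theorem HasRainbowHamiltonianList.hasRainbowHamiltonianPath {V ι : Type*} [DecidableEq V]
    [Nonempty ι] {G : ι → SimpleGraph V} {u v : V} (h : HasRainbowHamiltonianList G u v) :
    HasRainbowHamiltonianPath G u v := by
  obtain ⟨l, C, h, hC, hl, hz, hu, hv⟩ := h
  obtain ⟨p, c, rfl, hc, rfl⟩ := h.exists_walk hl hu hv
  refine ⟨p, fun a => List.count_eq_one_of_mem hl (hz a), fun e => c e, ?_, ?_⟩
  · intro e f hef
    have he := p.mem_edges_toSubgraph.1 e.2
    have hf := p.mem_edges_toSubgraph.1 f.2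
    exact Subtype.ext (List.inj_on_of_nodup_map (Multiset.coe_nodup.1 hC) he hf hef)
  · intro e
    exact hc e (p.mem_edges_toSubgraph.1 e.2)

/-! ### Sums along a list with a shift by one -/

/-- Pairing `g` at each entry with `f` at the next leaves over only `f` at the first entry and `g`
at the last. -/
theorem List.sum_map_add_sum_map_le {α : Type*} (f g : α → ℕ) (t : ℕ) (l : List α) (a z : α)
    (hz : (a :: l).getLast? = some z) (h : ∀ p q, [p, q] <:+: a :: l → g p + f q ≤ t) :
    ((a :: l).map f).sum + ((a :: l).map g).sum ≤ t * l.length + f a + g z := by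
  induction l generalizing a with
  | nil =>
    obtain rfl : a = z := by simpa using hz
    simp
  | cons b l ih =>
    have h₁ := ih b (by simpa using hz) fun p q hpq =>
      h p q (hpq.trans (List.suffix_cons _ _).isInfix)
    have h₂ := h a b ⟨[], l, rfl⟩
    simp only [List.map_cons, List.sum_cons, List.length_cons, mul_add] at h₁ ⊢
    omega

theorem List.sum_map_add_sum_map_lt {α : Type*} (f g : α → ℕ) (t : ℕ) (l : List α) (a z : α)
    (hz : (a :: l).getLast? = some z) (h : ∀ p q, [p, q] <:+: a :: l → g p + f q ≤ t)
    {p q : α} (hpq : [p, q] <:+: a :: l) (hlt : g p + f q < t) :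
    ((a :: l).map f).sum + ((a :: l).map g).sum < t * l.length + f a + g z := by
  induction l generalizing a with
  | nil => simpa using hpq.length_le
  | cons b l ih =>
    have h' : ∀ p q, [p, q] <:+: b :: l → g p + f q ≤ t := fun p q hpq =>
      h p q (hpq.trans (List.suffix_cons _ _).isInfix)
    have h₂ := h a b ⟨[], l, rfl⟩
    simp only [List.map_cons, List.sum_cons, List.length_cons, mul_add] at ih ⊢
    rcases List.infix_cons_iff.1 hpq with hp | hpq
    · have h₁ := List.sum_map_add_sum_map_le f g t l b z (by simpa using hz) h'
      obtain ⟨s, hs⟩ := hp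
      simp only [List.cons_append, List.cons.injEq, List.nil_append] at hs
      obtain ⟨rfl, rfl, -⟩ := hs
      simp only [List.map_cons, List.sum_cons] at h₁
      omega
    · have h₁ := ih b (by simpa using hz) h' hpq
      omega

/-- The number of neighbors of `x`, as a sum of indicators. -/
noncomputable def SimpleGraph.degreeSum {V : Type*} [Fintype V] (H : SimpleGraph V) (x : V) : ℕ :=
  open Classical in ∑ z : V, if H.Adj x z then 1 else 0

/-- Every two distinct non-adjacent vertices have degree sum at least the number of vertices. -/
def OreCondition {V : Type*} [Fintype V] (H : SimpleGraph V) : Prop :=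
  ∀ x y, x ≠ y → ¬ H.Adj x y → Fintype.card V ≤ H.degreeSum x + H.degreeSum y

theorem exists_color_notMem {ι : Type*} [Fintype ι] (C : Multiset ι)
    (hC : Multiset.card C < Fintype.card ι) : ∃ a, a ∉ C := by
  classical
  by_contra! h
  have h₁ : C.toFinset = Finset.univ := by ext; simp [h]
  have h₂ := Multiset.toFinset_card_le C
  rw [h₁, Finset.card_univ] at h₂
  omega

/-! ### Rotations and the tight degree count -/

section TwoPaths

variable {V ι : Type*} {G : ι → SimpleGraph V} {u v x y : V} {L R : List V} {C₁ C₂ : Multiset ι}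
  {i s : ι}

/-- Disjoint rainbow paths `L` from `x` to `u` and `R` from `y` to `v` covering all vertices. -/
structure SplitPath (G : ι → SimpleGraph V) (u v x y : V) (L R : List V)
    (C₁ C₂ : Multiset ι) : Prop where
  left : RainbowList G L C₁
  right : RainbowList G R C₂
  colors : (C₁ + C₂).Nodup
  nodup : (L ++ R).Nodup
  mem : ∀ z, z ∈ L ++ R
  headL : L.head? = some x
  lastL : L.getLast? = some u
  headR : R.head? = some y
  lastR : R.getLast? = some v

theorem SplitPath.symm (h : SplitPath G u v x y L R C₁ C₂) : SplitPath G v u y x R L C₂ C₁ where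
  left := h.right
  right := h.left
  colors := add_comm C₁ C₂ ▸ h.colors
  nodup := List.nodup_append_comm.1 h.nodup
  mem z := by have := h.mem z; simp only [List.mem_append] at this ⊢; exact this.symm
  headL := h.headR
  lastL := h.lastR
  headR := h.headL
  lastR := h.lastL

theorem SplitPath.not_adj (h : SplitPath G u v x y L R C₁ C₂)
    (hN : ¬ HasRainbowHamiltonianList G u v) (hi : i ∉ C₁ + C₂) : ¬ (G i).Adj x y := by
  intro hxy
  refine hN ⟨L.reverse ++ R, i ::ₘ (C₁ + C₂), h.left.reverse.append h.right (p := x) (q := y)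
    (by simp [h.headL]) h.headR hxy, Multiset.nodup_cons.2 ⟨hi, h.colors⟩, ?_, ?_, ?_, ?_⟩
  · exact ((List.reverse_perm L).append_right R).nodup_iff.2 h.nodup
  · intro z
    simpa using h.mem z
  · simp [h.lastL, List.head?_append]
  · simp [h.lastR, List.getLast?_append]

/-- Otherwise `u … q x … p y … v` is a rainbow Hamiltonian path: the edge `pq` is dropped, and `xq`,
`yp` take the two unused colors. -/
theorem SplitPath.not_adj_and_adj (h : SplitPath G u v x y L R C₁ C₂)
    (hN : ¬ HasRainbowHamiltonianList G u v) (hi : i ∉ C₁ + C₂) (hs : s ∉ C₁ + C₂) (his : i ≠ s)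
    {p q : V} (hpq : [p, q] <:+: L) : ¬ ((G i).Adj x q ∧ (G s).Adj y p) := by
  rintro ⟨hxq, hyp⟩
  obtain ⟨l₁, l₂, hL⟩ := hpq
  obtain rfl : l₁ ++ p :: q :: l₂ = L := by simpa using hL
  obtain ⟨c, D₁, D₂, rfl, -, h₁, h₂⟩ := h.left.split
  have hc := h.colors
  simp only [Multiset.cons_add, Multiset.nodup_cons, Multiset.mem_cons, not_or] at hc hi hs
  have hx : (l₁ ++ [p]).head? = some x := by
    have := h.headL
    cases l₁ <;> simpa using this
  have hu : (q :: l₂).getLast? = some u := by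
    have := h.lastL
    simpa [List.getLast?_append, List.getLast?_cons] using this
  have hpath := (h₂.reverse.append h₁ (p := q) (q := x) (by simp) hx hxq.symm).append h.right
    (p := p) (q := y) (by rw [← List.append_assoc, List.getLast?_concat]) h.headR hyp.symm
  refine hN ⟨_, _, hpath, ?_, ?_, ?_, ?_, ?_⟩
  · simp only [Multiset.cons_add, Multiset.nodup_cons, Multiset.mem_cons, not_or]
    rw [add_comm D₂ D₁]
    exact ⟨⟨his.symm, hs.2⟩, hi.2, hc.2⟩
  · refine List.Perm.nodup (List.Perm.append_right R ?_) h.nodup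
    have := ((List.reverse_perm (q :: l₂)).append_right (l₁ ++ [p])).trans List.perm_append_comm
    simpa using this.symm
  · intro z
    have := h.mem z
    simp only [List.mem_append, List.mem_cons, List.mem_reverse, List.not_mem_nil] at this ⊢
    tauto
  · simp only [List.head?_append, List.head?_reverse, hu]
    rfl
  · rw [List.getLast?_append, h.lastR]
    rfl

variable [Fintype V]

theorem degreeSum_eq_sum_map (H : SimpleGraph V) (x : V) {l : List V} (hl : l.Nodup)
    (hz : ∀ z, z ∈ l) :
    H.degreeSum x = (open Classical in (l.map fun z => if H.Adj x z then 1 else 0).sum) := by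
  classical
  rw [← List.sum_toFinset _ hl, SimpleGraph.degreeSum]
  congr 1
  · symm
    ext z
    simp [hz]

theorem SplitPath.length_add_length (h : SplitPath G u v x y L R C₁ C₂) :
    Fintype.card V = L.length + R.length := by
  classical
  rw [← List.length_append, ← List.toFinset_card_of_nodup h.nodup, ← Finset.card_univ]
  congr 1
  symm
  ext z
  simpa using h.mem z

/-- Ore's condition in colors `i` and `s` gives total degree at least `2n` at `x` and `y`. The
rotations allow at most 2 per consecutive pair, hence `2(n - 2)`, plus at most 2 each from `u` and
`v`. Equality holds throughout. -/
theorem SplitPath.adj_dichotomy (h : SplitPath G u v x y L R C₁ C₂)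
    (hO : ∀ i, OreCondition (G i))
    (hN : ¬ HasRainbowHamiltonianList G u v) (hi : i ∉ C₁ + C₂) (hs : s ∉ C₁ + C₂) (his : i ≠ s) :
    (G i).Adj x v ∧ (G i).Adj y u ∧
      (∀ p q, [p, q] <:+: L → ((G i).Adj x q ↔ ¬ (G s).Adj y p)) ∧
      (∀ p q, [p, q] <:+: R → ((G i).Adj y q ↔ ¬ (G s).Adj x p)) := by
  classical
  have hN' : ¬ HasRainbowHamiltonianList G v u := fun h => hN h.symm
  have hi' : i ∉ C₂ + C₁ := add_comm C₁ C₂ ▸ hi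
  have hs' : s ∉ C₂ + C₁ := add_comm C₁ C₂ ▸ hs
  have hxy : x ≠ y := by
    rintro rfl
    exact (List.disjoint_of_nodup_append h.nodup) (List.mem_of_mem_head? h.headL)
      (List.mem_of_mem_head? h.headR)
  have e₁ := hO i x y hxy (h.not_adj hN hi)
  have e₂ := hO s x y hxy (h.not_adj hN hs)
  -- Both colors are added up because a rotation pairs an edge in one of them with an edge in the
  -- other.
  set f : V → ℕ := fun z => (if (G i).Adj x z then 1 else 0) + (if (G s).Adj x z then 1 else 0)
    with hf
  set g : V → ℕ := fun z => (if (G i).Adj y z then 1 else 0) + (if (G s).Adj y z then 1 else 0)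
    with hg
  have key := h.length_add_length
  have hL : ∀ p q, [p, q] <:+: L → g p + f q ≤ 2 := by
    intro p q hpq
    have h₁ := h.not_adj_and_adj hN hi hs his hpq
    have h₂ := h.not_adj_and_adj hN hs hi his.symm hpq
    simp only [hf, hg]
    grind
  have hR : ∀ p q, [p, q] <:+: R → f p + g q ≤ 2 := by
    intro p q hpq
    have h₁ := h.symm.not_adj_and_adj hN' hi' hs' his hpq
    have h₂ := h.symm.not_adj_and_adj hN' hs' hi' his.symm hpq
    simp only [hf, hg]
    grind
  have hfx : f x = 0 := by simp [hf]
  have hgy : g y = 0 := by simp [hg]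
  have hfv : f v ≤ 2 := by simp only [hf]; grind
  have hgu : g u ≤ 2 := by simp only [hg]; grind
  have htot : 2 * (L.length + R.length) ≤
      ((L.map f).sum + (L.map g).sum) + ((R.map g).sum + (R.map f).sum) := by
    rw [degreeSum_eq_sum_map _ _ h.nodup h.mem, degreeSum_eq_sum_map _ _ h.nodup h.mem] at e₁ e₂
    simp only [List.map_append, List.sum_append, hf, hg, List.sum_map_add] at e₁ e₂ ⊢
    omega
  obtain ⟨L', rfl⟩ : ∃ L', L = x :: L' := by
    have := h.headL
    cases L <;> simp_all
  obtain ⟨R', rfl⟩ : ∃ R', R = y :: R' := by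
    have := h.headR
    cases R <;> simp_all
  have b₁ := List.sum_map_add_sum_map_le f g 2 L' x u h.lastL hL
  have b₂ := List.sum_map_add_sum_map_le g f 2 R' y v h.lastR hR
  rw [List.length_cons, List.length_cons] at htot
  refine ⟨?_, ?_, ?_, ?_⟩
  · by_contra hcon
    have : f v ≤ 1 := by simp only [hf, hcon]; grind
    omega
  · by_contra hcon
    have : g u ≤ 1 := by simp only [hg, hcon]; grind
    omega
  · intro p q hpq
    have h₁ := h.not_adj_and_adj hN hi hs his hpq
    have h₂ := h.not_adj_and_adj hN hs hi his.symm hpq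
    have : ¬ (g p + f q < 2) := fun hlt => by
      have := List.sum_map_add_sum_map_lt f g 2 L' x u h.lastL hL hpq hlt
      omega
    simp only [hf, hg] at this
    grind
  · intro p q hpq
    have h₁ := h.symm.not_adj_and_adj hN' hi' hs' his hpq
    have h₂ := h.symm.not_adj_and_adj hN' hs' hi' his.symm hpq
    have : ¬ (f p + g q < 2) := fun hlt => by
      have := List.sum_map_add_sum_map_lt g f 2 R' y v h.lastR hR hpq hlt
      omega
    simp only [hf, hg] at this
    grind

end TwoPaths

/-! ### Two-path covers and their four free colors -/

section Critical

variable {V ι : Type*}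

/-- Two disjoint rainbow paths `P` and `Q` with color set `C`, covering all vertices
except `u` and `v`. -/
structure TwoPathCover (G : ι → SimpleGraph V) (u v : V) (P Q : List V) (C : Multiset ι) :
    Prop where
  exists_colors : ∃ C₁ C₂, RainbowList G P C₁ ∧ RainbowList G Q C₂ ∧ C = C₁ + C₂
  colors : C.Nodup
  nodup : (P ++ Q).Nodup
  mem : ∀ z, z ∈ P ++ Q ↔ z ≠ u ∧ z ≠ v

namespace TwoPathCover

variable {G : ι → SimpleGraph V} {u v : V} {P Q : List V} {C : Multiset ι}

theorem swap (h : TwoPathCover G u v P Q C) : TwoPathCover G u v Q P C where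
  exists_colors := by
    obtain ⟨C₁, C₂, h₁, h₂, rfl⟩ := h.exists_colors
    exact ⟨C₂, C₁, h₂, h₁, add_comm _ _⟩
  colors := h.colors
  nodup := List.nodup_append_comm.1 h.nodup
  mem z := by rw [← h.mem z, List.mem_append, List.mem_append, or_comm]

theorem rev (h : TwoPathCover G u v P Q C) : TwoPathCover G u v P.reverse Q C where
  exists_colors := by
    obtain ⟨C₁, C₂, h₁, h₂, rfl⟩ := h.exists_colors
    exact ⟨C₁, C₂, h₁.reverse, h₂, rfl⟩
  colors := h.colors
  nodup := ((List.reverse_perm P).append_right Q).nodup_iff.2 h.nodup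
  mem z := by rw [← h.mem z, List.mem_append, List.mem_append, List.mem_reverse]

theorem exists_head_left (h : TwoPathCover G u v P Q C) : ∃ x, P.head? = some x := by
  obtain ⟨C₁, C₂, h₁, -⟩ := h.exists_colors
  exact ⟨_, List.head?_eq_some_head h₁.ne_nil⟩

/-- Joining the head `y` of `Q` to a vertex `z` of `P`. -/
theorem connect {P₁ P₂ : List V} {y z : V} {a : ι} (h : TwoPathCover G u v (P₁ ++ z :: P₂) Q C)
    (hP₁ : P₁ ≠ []) (hy : Q.head? = some y) (ha : a ∉ C) (hyz : (G a).Adj y z) :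
    ∃ C', TwoPathCover G u v P₁ (P₂.reverse ++ z :: Q) C' ∧ ∀ b, b ∉ C → b ≠ a → b ∉ C' := by
  obtain ⟨C₁, C₂, h₁, h₂, rfl⟩ := h.exists_colors
  obtain ⟨l, w, rfl⟩ : ∃ l w, P₁ = l ++ [w] := ⟨_, _, (List.dropLast_concat_getLast hP₁).symm⟩
  have h₁' : RainbowList G (l ++ w :: z :: P₂) C₁ := by simpa using h₁
  obtain ⟨c, D₁, D₂, rfl, -, hl, hr⟩ := h₁'.split
  have hnew := hr.reverse.append h₂ (by simp) hy hyz.symm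
  have hc := h.colors
  simp only [Multiset.cons_add, Multiset.nodup_cons, Multiset.mem_cons, not_or] at hc ha ⊢
  -- The color `c` of the cut edge `wz` is released and `a` takes its place.
  refine ⟨D₁ + a ::ₘ (D₂ + C₂), ⟨⟨_, _, hl, by simpa using hnew, rfl⟩, ?_, ?_, ?_⟩, ?_⟩
  · rw [Multiset.add_cons, Multiset.nodup_cons, ← add_assoc]
    exact ⟨ha.2, hc.2⟩
  · refine List.Perm.nodup ?_ h.nodup
    classical
    refine List.perm_iff_count.2 fun t => ?_
    simp only [List.count_append, List.count_cons, List.count_reverse]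
    omega
  · intro z'
    rw [← h.mem z']
    simp only [List.mem_append, List.mem_cons, List.mem_reverse]
    tauto
  · intro b hb hba
    simp only [Multiset.mem_add, Multiset.mem_cons] at hb ⊢
    tauto

/-- Closing `P` to a cycle and cutting it before the vertex `q`. -/
theorem rotate {P₁ P₂ : List V} {p q x z : V} {a c : ι} {C₁ C₂ D : Multiset ι}
    (h : TwoPathCover G u v (P₁ ++ p :: q :: P₂) Q C) (hC : C = c ::ₘ (C₁ + C₂ + D))
    (h₁ : RainbowList G (P₁ ++ [p]) C₁) (h₂ : RainbowList G (q :: P₂) C₂)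
    (hQ : RainbowList G Q D) (hx : (P₁ ++ [p]).head? = some x)
    (hz : (q :: P₂).getLast? = some z) (ha : a ∉ C) (hxz : (G a).Adj x z) :
    TwoPathCover G u v ((q :: P₂) ++ (P₁ ++ [p])) Q (a ::ₘ (C₁ + C₂ + D)) := by
  subst hC
  have hc := h.colors
  simp only [Multiset.nodup_cons, Multiset.mem_cons, not_or] at hc ha
  refine ⟨⟨_, _, h₂.append h₁ hz hx hxz.symm, hQ, ?_⟩, Multiset.nodup_cons.2 ⟨ha.2, hc.2⟩, ?_, ?_⟩
  · rw [Multiset.cons_add, add_comm C₂ C₁]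
  · refine List.Perm.nodup (List.Perm.append_right Q ?_) h.nodup
    have : (P₁ ++ [p] ++ (q :: P₂)).Perm ((q :: P₂) ++ (P₁ ++ [p])) := List.perm_append_comm
    simpa using this
  · intro z'
    rw [← h.mem z']
    simp only [List.mem_append, List.mem_cons, List.not_mem_nil]
    tauto

/-- Changing the color of one edge of `P`. -/
theorem recolor {P₁ P₂ : List V} {p q : V} {a c : ι} {C₁ C₂ D : Multiset ι}
    (h : TwoPathCover G u v (P₁ ++ p :: q :: P₂) Q C) (hC : C = c ::ₘ (C₁ + C₂ + D))
    (h₁ : RainbowList G (P₁ ++ [p]) C₁) (h₂ : RainbowList G (q :: P₂) C₂)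
    (hQ : RainbowList G Q D) (ha : a ∉ C) (hpq : (G a).Adj p q) :
    TwoPathCover G u v (P₁ ++ p :: q :: P₂) Q (a ::ₘ (C₁ + C₂ + D)) := by
  subst hC
  have hc := h.colors
  simp only [Multiset.nodup_cons, Multiset.mem_cons, not_or] at hc ha
  refine ⟨⟨a ::ₘ (C₁ + C₂), D, ?_, hQ, by rw [Multiset.cons_add]⟩,
    Multiset.nodup_cons.2 ⟨ha.2, hc.2⟩, h.nodup, h.mem⟩
  have := h₁.append h₂ (by simp) rfl hpq
  simpa using this

theorem exists_edge_of_mem {c : ι} (h : TwoPathCover G u v P Q C) (hc : c ∈ C) :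
    ∃ P' Q', (P' = P ∧ Q' = Q ∨ P' = Q ∧ Q' = P) ∧ TwoPathCover G u v P' Q' C ∧
    ∃ P₁ p q P₂ C₁ C₂ D, P' = P₁ ++ p :: q :: P₂ ∧ C = c ::ₘ (C₁ + C₂ + D) ∧
      RainbowList G (P₁ ++ [p]) C₁ ∧ RainbowList G (q :: P₂) C₂ ∧ RainbowList G Q' D := by
  obtain ⟨C₁, C₂, h₁, h₂, rfl⟩ := h.exists_colors
  rcases Multiset.mem_add.1 hc with hc | hc
  · obtain ⟨l₁, p, q, l₂, D₁, D₂, hl, rfl, -, hl₁, hl₂⟩ := h₁.exists_edge_of_mem hc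
    exact ⟨P, Q, .inl ⟨rfl, rfl⟩, h, l₁, p, q, l₂, D₁, D₂, C₂, hl, by rw [Multiset.cons_add],
      hl₁, hl₂, h₂⟩
  · obtain ⟨l₁, p, q, l₂, D₁, D₂, hl, rfl, -, hl₁, hl₂⟩ := h₂.exists_edge_of_mem hc
    exact ⟨Q, P, .inr ⟨rfl, rfl⟩, h.swap, l₁, p, q, l₂, D₁, D₂, C₁, hl,
      by rw [add_comm, Multiset.cons_add], hl₁, hl₂, h₁⟩

end TwoPathCover

variable [Fintype V]

namespace TwoPathCover

variable {G : ι → SimpleGraph V} {u v : V} {P Q : List V} {C : Multiset ι}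

/-- The two paths have `n - 2` vertices, hence `n - 4` edges. With `n` colors available, four stay
free. -/
theorem card_add (h : TwoPathCover G u v P Q C) (huv : u ≠ v) :
    Multiset.card C + 4 = Fintype.card V := by
  classical
  obtain ⟨C₁, C₂, h₁, h₂, rfl⟩ := h.exists_colors
  have hn : (u :: v :: (P ++ Q)).Nodup := by
    have hu : u ∉ P ++ Q := fun hu => ((h.mem u).1 hu).1 rfl
    have hv : v ∉ P ++ Q := fun hv => ((h.mem v).1 hv).2 rfl
    simp only [List.nodup_cons, List.mem_cons, not_or]
    exact ⟨⟨huv, hu⟩, hv, h.nodup⟩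
  have : Fintype.card V = (u :: v :: (P ++ Q)).length := by
    rw [← List.toFinset_card_of_nodup hn, ← Finset.card_univ]
    congr 1
    symm
    ext z
    have := h.mem z
    simp only [List.mem_toFinset, List.mem_cons, Finset.mem_univ, iff_true]
    tauto
  rw [this]
  simp [← h₁.card, ← h₂.card]
  omega

end TwoPathCover

variable [Fintype ι]

/-- A collection of Ore graphs without rainbow Hamiltonian `u,v`-path in which `u` and `v` are
adjacent to all other vertices in every color. -/
structure IsCritical (G : ι → SimpleGraph V) (u v : V) : Prop where
  ore : ∀ i, OreCondition (G i)
  noPath : ¬ HasRainbowHamiltonianList G u v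
  adj_left : ∀ i w, w ≠ u → (G i).Adj w u
  adj_right : ∀ i w, w ≠ v → (G i).Adj w v
  card : Fintype.card ι = Fintype.card V
  ne : u ≠ v

namespace TwoPathCover

variable {G : ι → SimpleGraph V} {u v : V} {P Q : List V} {C : Multiset ι}

theorem exists_notMem (h : TwoPathCover G u v P Q C) (hG : IsCritical G u v) (a b c : ι) :
    ∃ d, d ∉ C ∧ d ≠ a ∧ d ≠ b ∧ d ≠ c := by
  obtain ⟨d, hd⟩ := exists_color_notMem (a ::ₘ b ::ₘ c ::ₘ C) (by
    have := h.card_add hG.ne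
    have := hG.card
    simp only [Multiset.card_cons]
    omega)
  simp only [Multiset.mem_cons, not_or] at hd
  exact ⟨d, hd.2.2.2, hd.1, hd.2.1, hd.2.2.1⟩

/-- The other two free colors `c`, `d` attach `u` to the end of `P` and `v` to the end of `Q`, which
gives a `SplitPath` still missing `a` and `b`. -/
theorem dichotomy_of_ne {a b : ι} {x y : V} (h : TwoPathCover G u v P Q C)
    (hG : IsCritical G u v) (ha : a ∉ C) (hb : b ∉ C) (hab : a ≠ b)
    (hx : P.head? = some x) (hy : Q.head? = some y) :
    ¬ (G a).Adj x y ∧ (∀ p q, [p, q] <:+: P → ((G a).Adj x q ↔ ¬ (G b).Adj y p)) ∧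
      ∀ z, P.getLast? = some z → ¬ (G b).Adj y z := by
  obtain ⟨c, hc, hca, hcb, -⟩ := h.exists_notMem hG a b a
  obtain ⟨d, hd, hda, hdb, hdc⟩ := h.exists_notMem hG a b c
  obtain ⟨C₁, C₂, h₁, h₂, rfl⟩ := h.exists_colors
  obtain ⟨P', z, rfl⟩ : ∃ l w, P = l ++ [w] :=
    ⟨_, _, (List.dropLast_concat_getLast h₁.ne_nil).symm⟩
  obtain ⟨Q', t, rfl⟩ : ∃ l w, Q = l ++ [w] :=
    ⟨_, _, (List.dropLast_concat_getLast h₂.ne_nil).symm⟩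
  have hz : z ≠ u := ((h.mem z).1 (by simp)).1
  have ht : t ≠ v := ((h.mem t).1 (by simp)).2
  have hxu : x ≠ u := ((h.mem x).1 (List.mem_append_left _ (List.mem_of_mem_head? hx))).1
  have hu : u ∉ P' ++ [z] ++ (Q' ++ [t]) := fun hu => ((h.mem u).1 hu).1 rfl
  have hv : v ∉ P' ++ [z] ++ (Q' ++ [t]) := fun hv => ((h.mem v).1 hv).2 rfl
  have hS : SplitPath G u v x y (P' ++ [z] ++ [u]) (Q' ++ [t] ++ [v]) (c ::ₘ (C₁ + 0))
      (d ::ₘ (C₂ + 0)) := by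
    refine ⟨h₁.append (.single u) (p := z) (by simp) rfl (hG.adj_left _ _ hz),
      h₂.append (.single v) (p := t) (by simp) rfl (hG.adj_right _ _ ht), ?_, ?_, ?_, ?_, by simp,
      ?_, by simp⟩
    · simp only [add_zero, Multiset.cons_add, Multiset.add_cons, Multiset.nodup_cons,
        Multiset.mem_cons, not_or]
      exact ⟨⟨hdc, hd⟩, hc, h.colors⟩
    · have hp : (u :: v :: (P' ++ [z] ++ (Q' ++ [t]))).Perm
          (P' ++ [z] ++ [u] ++ (Q' ++ [t] ++ [v])) := by
        classical
        refine List.perm_iff_count.2 fun w => ?_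
        simp only [List.count_append, List.count_cons, List.count_nil]
        omega
      refine hp.nodup ?_
      simp only [List.nodup_cons, List.mem_cons, not_or]
      exact ⟨⟨hG.ne, hu⟩, hv, h.nodup⟩
    · intro w
      have := h.mem w
      simp only [List.mem_append, List.mem_singleton] at this ⊢
      tauto
    · rw [List.head?_append, hx]; rfl
    · rw [List.head?_append, hy]; rfl
  have ha' : a ∉ c ::ₘ (C₁ + 0) + d ::ₘ (C₂ + 0) := by
    simp only [add_zero, Multiset.cons_add, Multiset.add_cons, Multiset.mem_cons, not_or]
    exact ⟨hda.symm, hca.symm, ha⟩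
  have hb' : b ∉ c ::ₘ (C₁ + 0) + d ::ₘ (C₂ + 0) := by
    simp only [add_zero, Multiset.cons_add, Multiset.add_cons, Multiset.mem_cons, not_or]
    exact ⟨hdb.symm, hcb.symm, hb⟩
  obtain ⟨-, -, hP, -⟩ := hS.adj_dichotomy hG.ore hG.noPath ha' hb' hab
  refine ⟨hS.not_adj hG.noPath ha', fun p q hpq => hP p q (hpq.trans ⟨[], [u], by simp⟩), ?_⟩
  intro z' hz'
  obtain rfl : z = z' := by simpa using hz'
  -- The dichotomy at the pair `z, u`, where `x ~ u` is known.
  exact (hP z u ⟨P', [], by simp⟩).1 (hG.adj_left _ _ hxu)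

/-- In colors not used on `P` and `Q`, the neighborhoods of the heads of the two paths
determine each other. -/
theorem adj_iff {a b : ι} {x y p q : V} (h : TwoPathCover G u v P Q C)
    (hG : IsCritical G u v) (ha : a ∉ C) (hb : b ∉ C)
    (hx : P.head? = some x) (hy : Q.head? = some y) (hpq : [p, q] <:+: P) :
    (G a).Adj x q ↔ ¬ (G b).Adj y p := by
  obtain ⟨c, hc, hca, hcb, -⟩ := h.exists_notMem hG a b a
  obtain ⟨d, hd, hda, hdb, hdc⟩ := h.exists_notMem hG a b c
  have key : ∀ {a b}, a ∉ C → b ∉ C → a ≠ b → ((G a).Adj x q ↔ ¬ (G b).Adj y p) :=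
    fun ha hb hab => (h.dichotomy_of_ne hG ha hb hab hx hy).2.1 p q hpq
  -- When `a = b` the dichotomy does not apply directly; the detour through `c` and `d` compares
  -- only distinct colors.
  rw [key ha hc hca.symm, ← key hd hc hdc, key hd hb hdb]

theorem not_adj_head {a : ι} {x y : V} (h : TwoPathCover G u v P Q C)
    (hG : IsCritical G u v) (ha : a ∉ C) (hx : P.head? = some x) (hy : Q.head? = some y) :
    ¬ (G a).Adj x y := by
  obtain ⟨c, hc, hca, -⟩ := h.exists_notMem hG a a a
  exact (h.dichotomy_of_ne hG ha hc hca.symm hx hy).1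

theorem not_adj_last {a : ι} {y z : V} (h : TwoPathCover G u v P Q C)
    (hG : IsCritical G u v) (ha : a ∉ C) (hz : P.getLast? = some z) (hy : Q.head? = some y) :
    ¬ (G a).Adj y z :=
  fun hyz => h.rev.not_adj_head hG ha (by simpa using hz) hy hyz.symm

end TwoPathCover

end Critical

/-! ### Consecutive pairs in lists -/

theorem List.pair_infix_append_cons {α : Type*} {p q z : α} {l₁ l₂ : List α}
    (h : [p, q] <:+: l₁ ++ z :: l₂) : [p, q] <:+: l₁ ++ [z] ∨ [p, q] <:+: z :: l₂ := by
  obtain ⟨s, t, h⟩ := h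
  rw [List.append_assoc] at h
  rcases List.append_eq_append_iff.1 h with ⟨r, rfl, hr⟩ | ⟨r, rfl, hr⟩
  · match r, hr with
    | [], hr => exact .inr ⟨[], t, by simpa using hr⟩
    | [p'], hr =>
      simp only [List.cons_append, List.nil_append, List.cons.injEq] at hr
      obtain ⟨rfl, rfl, -⟩ := hr
      exact .inl ⟨s, [], by simp⟩
    | p' :: q' :: r, hr =>
      simp only [List.cons_append, List.nil_append, List.cons.injEq] at hr
      obtain ⟨rfl, rfl, -⟩ := hr
      exact .inl ⟨s, r ++ [z], by simp⟩
  · exact .inr ⟨r, t, by simp [hr]⟩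

theorem List.pair_infix_reverse {α : Type*} {p q : α} {l : List α} (h : [p, q] <:+: l) :
    [q, p] <:+: l.reverse := by
  simpa using List.reverse_infix.2 h

theorem List.head?_eq_or_exists_pair_infix {α : Type*} {w : α} {l : List α} (h : w ∈ l) :
    l.head? = some w ∨ ∃ p, [p, w] <:+: l := by
  obtain ⟨s, t, rfl⟩ := List.append_of_mem h
  rcases s.eq_nil_or_concat' with rfl | ⟨s, p, rfl⟩
  · simp
  · exact .inr ⟨p, s, t, by simp⟩

theorem List.getLast?_eq_or_exists_pair_infix {α : Type*} {w : α} {l : List α} (h : w ∈ l) :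
    l.getLast? = some w ∨ ∃ q, [w, q] <:+: l := by
  rcases List.head?_eq_or_exists_pair_infix (List.mem_reverse.2 h) with h | ⟨q, h⟩
  · exact .inl (by simpa using h)
  · exact .inr ⟨q, by simpa using List.pair_infix_reverse h⟩

theorem List.mem_of_pair_infix_left {α : Type*} {p q : α} {l : List α} (h : [p, q] <:+: l) :
    p ∈ l := h.subset (by simp)

theorem List.mem_of_pair_infix_right {α : Type*} {p q : α} {l : List α} (h : [p, q] <:+: l) :
    q ∈ l := h.subset (by simp)

/-! ### Alternation forced by an edge from an end to the other path -/

namespace TwoPathCover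

variable {V ι : Type*} [Fintype V] [Fintype ι] {G : ι → SimpleGraph V} {u v : V} {P Q : List V}
  {C : Multiset ι}

/-- Let `x`, `r` be the ends of `P`. Joining `y` to `z` by color `a` makes `x` and `r` heads of
different paths, so `r ~ p` iff not `x ~ q`. In the old cover, `x ~ q` iff not `y ~ p`, and, with
`P` reversed, `r ~ p` iff not `y ~ q`. -/
theorem alternate_right {P₁ P₂ : List V} {a b : ι} {y z p q : V}
    (h : TwoPathCover G u v (P₁ ++ z :: P₂) Q C)
    (hG : IsCritical G u v) (ha : a ∉ C) (hb : b ∉ C) (hba : b ≠ a) (hy : Q.head? = some y)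
    (hyz : (G a).Adj y z) (hpq : [p, q] <:+: z :: P₂) :
    (G b).Adj y p ↔ ¬ (G b).Adj y q := by
  obtain ⟨x, P₁, rfl⟩ : ∃ x l, P₁ = x :: l := by
    cases P₁ with
    | nil => exact absurd hyz.symm (h.not_adj_head hG ha rfl hy)
    | cons x l => exact ⟨x, l, rfl⟩
  rcases P₂.eq_nil_or_concat' with rfl | ⟨P₂, r, rfl⟩
  · exact absurd hyz (h.not_adj_last hG ha (by simp [List.getLast?_cons]) hy)
  obtain ⟨C', h', hC'⟩ := h.connect (by simp) hy ha hyz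
  have hb' := hC' b hb hba
  have hqp : [q, p] <:+: (P₂ ++ [r]).reverse ++ z :: Q := by
    refine (List.pair_infix_reverse hpq).trans ⟨[], Q, ?_⟩
    simp
  have hpq' : [p, q] <:+: x :: P₁ ++ z :: (P₂ ++ [r]) :=
    hpq.trans (List.suffix_append _ _).isInfix
  have e₁ := h'.swap.adj_iff hG hb' hb' (x := r) (y := x) (by simp) rfl hqp
  have e₂ := h.adj_iff hG hb hb (x := x) (y := y) rfl hy hpq'
  have e₃ := h.rev.adj_iff hG hb hb (x := r) (y := y) (by simp) hy (List.pair_infix_reverse hpq')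
  tauto

/-- A pair before `z` is reached by reversing `P`. -/
theorem alternate {a b : ι} {y z p q : V} (h : TwoPathCover G u v P Q C)
    (hG : IsCritical G u v) (ha : a ∉ C) (hb : b ∉ C) (hba : b ≠ a) (hy : Q.head? = some y)
    (hz : z ∈ P) (hyz : (G a).Adj y z) (hpq : [p, q] <:+: P) :
    (G b).Adj y p ↔ ¬ (G b).Adj y q := by
  obtain ⟨P₁, P₂, rfl⟩ := List.append_of_mem hz
  rcases List.pair_infix_append_cons hpq with hpq | hpq
  · have h' : TwoPathCover G u v (P₂.reverse ++ z :: P₁.reverse) Q C := by simpa using h.rev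
    have := h'.alternate_right hG ha hb hba hy hyz (p := q) (q := p)
      (by simpa using List.pair_infix_reverse hpq)
    tauto
  · exact h.alternate_right hG ha hb hba hy hyz hpq

/-- The neighborhood of an end vertex is the same in all unused colors. -/
theorem adj_congr {a b : ι} {y w : V} (h : TwoPathCover G u v P Q C)
    (hG : IsCritical G u v) (ha : a ∉ C) (hb : b ∉ C) (hy : Q.head? = some y)
    (hw : w ∈ P ++ Q) : (G a).Adj y w ↔ (G b).Adj y w := by
  obtain ⟨x, hx⟩ := h.exists_head_left
  rcases List.mem_append.1 hw with hw | hw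
  · rcases List.getLast?_eq_or_exists_pair_infix hw with hw | ⟨q, hq⟩
    · simp [h.not_adj_last hG ha hw hy, h.not_adj_last hG hb hw hy]
    · have e₁ := h.adj_iff hG ha ha hx hy hq
      have e₂ := h.adj_iff hG ha hb hx hy hq
      tauto
  · rcases List.head?_eq_or_exists_pair_infix hw with hw | ⟨p, hp⟩
    · obtain rfl : y = w := Option.some_inj.1 (hy.symm.trans hw)
      simp
    · rw [h.swap.adj_iff hG ha ha hy hx hp, h.swap.adj_iff hG hb ha hy hx hp]

end TwoPathCover

/-! ### Alternating covers and the independent set -/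

section Alternating

variable {V ι : Type*} {G : ι → SimpleGraph V} {u v : V} {P Q : List V} {C : Multiset ι}
  {f : V → Prop}

/-- A two-path cover whose paths alternate between `f` and its complement, start and end outside
`f`, and whose heads have neighborhood `f` in every unused color. -/
structure AlternatingCover (G : ι → SimpleGraph V) (u v : V) (P Q : List V) (C : Multiset ι)
    (f : V → Prop) : Prop where
  cover : TwoPathCover G u v P Q C
  altP : ∀ p q, [p, q] <:+: P → (f p ↔ ¬ f q)
  altQ : ∀ p q, [p, q] <:+: Q → (f p ↔ ¬ f q)
  headP : ∀ x, P.head? = some x → ¬ f x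
  headQ : ∀ x, Q.head? = some x → ¬ f x
  lastP : ∀ x, P.getLast? = some x → ¬ f x
  lastQ : ∀ x, Q.getLast? = some x → ¬ f x
  adjP : ∀ b ∉ C, ∀ x, P.head? = some x → ∀ w ∈ P ++ Q, (G b).Adj x w ↔ f w
  adjQ : ∀ b ∉ C, ∀ x, Q.head? = some x → ∀ w ∈ P ++ Q, (G b).Adj x w ↔ f w

theorem AlternatingCover.swap (h : AlternatingCover G u v P Q C f) :
    AlternatingCover G u v Q P C f where
  cover := h.cover.swap
  altP := h.altQ
  altQ := h.altP
  headP := h.headQ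
  headQ := h.headP
  lastP := h.lastQ
  lastQ := h.lastP
  adjP b hb x hx w hw := h.adjQ b hb x hx w (by rw [List.mem_append] at *; exact hw.symm)
  adjQ b hb x hx w hw := h.adjP b hb x hx w (by rw [List.mem_append] at *; exact hw.symm)

variable [Fintype V] [Fintype ι]

/-- The neighbors of `y` alternate along `P`, so the dichotomy gives `x` the same neighbors there.
Joining `y` to `z` puts `z` and `Q` on one path, to which `x` is joined through `z`, so its
neighbors alternate along `Q` as well. -/
theorem TwoPathCover.alternatingCover {a : ι} {y z : V} (h : TwoPathCover G u v P Q C)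
    (hG : IsCritical G u v) (ha : a ∉ C) (hy : Q.head? = some y)
    (hz : z ∈ P) (hyz : (G a).Adj y z) : AlternatingCover G u v P Q C ((G a).Adj y) := by
  obtain ⟨x, hx⟩ := h.exists_head_left
  obtain ⟨b, hb, hba, -⟩ := h.exists_notMem hG a a a
  obtain ⟨d, hd, hda, hdb, -⟩ := h.exists_notMem hG a b a
  have altP : ∀ p q, [p, q] <:+: P → ((G a).Adj y p ↔ ¬ (G a).Adj y q) := fun p q hpq => by
    rw [h.adj_congr hG ha hb hy (List.mem_append_left _ (List.mem_of_pair_infix_left hpq)),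
      h.adj_congr hG ha hb hy (List.mem_append_left _ (List.mem_of_pair_infix_right hpq))]
    exact h.alternate hG ha hb hba hy hz hyz hpq
  have hyx : ¬ (G a).Adj y x := fun hyx => h.not_adj_head hG ha hx hy hyx.symm
  have xP : ∀ b ∉ C, ∀ w ∈ P, (G b).Adj x w ↔ (G a).Adj y w := by
    intro b hb w hw
    rcases List.head?_eq_or_exists_pair_infix hw with hw | ⟨p, hp⟩
    · obtain rfl : x = w := Option.some_inj.1 (hx.symm.trans hw)
      simp [hyx]
    · have e₁ := h.adj_iff hG hb ha hx hy hp
      have e₂ := altP _ _ hp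
      tauto
  have xalt : ∀ p q, [p, q] <:+: Q → ((G d).Adj x p ↔ ¬ (G d).Adj x q) := by
    intro p q hpq
    have hxz : (G b).Adj x z := (xP b hb z hz).2 hyz
    obtain ⟨P₁, P₂, rfl⟩ := List.append_of_mem hz
    have hP₁ : P₁ ≠ [] := by
      rintro rfl
      obtain rfl : z = x := by simpa using hx
      exact hyx hyz
    obtain ⟨C', h', hC'⟩ := h.connect hP₁ hy ha hyz
    have hx' : P₁.head? = some x := by
      cases P₁ with
      | nil => simp at hP₁
      | cons _ _ => simpa using hx
    exact h'.swap.alternate hG (hC' b hb hba) (hC' d hd hda) hdb hx' (z := z) (by simp) hxz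
      (hpq.trans ⟨P₂.reverse ++ [z], [], by simp⟩)
  have xQ : ∀ b ∉ C, ∀ w ∈ Q, (G b).Adj x w ↔ (G a).Adj y w := by
    intro b hb w hw
    rw [h.swap.adj_congr hG hb hd hx (List.mem_append_left _ hw)]
    rcases List.head?_eq_or_exists_pair_infix hw with hw | ⟨p, hp⟩
    · obtain rfl : y = w := Option.some_inj.1 (hy.symm.trans hw)
      simp [h.not_adj_head hG hd hx hy]
    · have e₁ := h.swap.adj_iff hG ha hd hy hx hp
      have e₂ := xalt _ _ hp
      tauto
  refine ⟨h, altP, ?_, ?_, ?_, ?_, ?_, ?_, ?_⟩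
  · intro p q hpq
    rw [← xQ d hd p (List.mem_of_pair_infix_left hpq),
      ← xQ d hd q (List.mem_of_pair_infix_right hpq)]
    exact xalt p q hpq
  · intro x' hx'
    obtain rfl : x = x' := Option.some_inj.1 (hx.symm.trans hx')
    exact hyx
  · intro x' hx'
    obtain rfl : y = x' := Option.some_inj.1 (hy.symm.trans hx')
    simp
  · exact fun t ht => h.not_adj_last hG ha ht hy
  · intro t ht
    rw [← xQ d hd t (List.mem_of_getLast? ht)]
    exact h.swap.not_adj_last hG hd ht hx
  · intro b hb x' hx' w hw
    obtain rfl : x = x' := Option.some_inj.1 (hx.symm.trans hx')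
    exact (List.mem_append.1 hw).elim (xP b hb w) (xQ b hb w)
  · intro b hb x' hx' w hw
    obtain rfl : y = x' := Option.some_inj.1 (hy.symm.trans hx')
    exact h.adj_congr hG hb ha hy hw

namespace AlternatingCover

/-- If `w` is not the head, its predecessor `z` satisfies `f`, so the head `y` of `Q` can be joined
to `z`. This cuts `P` before `w` and makes `w` a head opposite `x`. Alternation persists across the
junction `zy`, and the dichotomy carries the known neighborhood `f` of `x` over to `w`. -/
theorem adj_iff_of_mem_left {b : ι} {w w' : V} (h : AlternatingCover G u v P Q C f)
    (hG : IsCritical G u v) (hb : b ∉ C) (hwP : w ∈ P) (hw : ¬ f w) (hw' : w' ∈ P ++ Q) :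
    (G b).Adj w w' ↔ f w' := by
  rcases List.head?_eq_or_exists_pair_infix hwP with hwP | ⟨z, hzw⟩
  · exact h.adjP b hb w hwP w' hw'
  have hz : f z := (h.altP _ _ hzw).2 hw
  obtain ⟨x, hx⟩ := h.cover.exists_head_left
  obtain ⟨y, hy⟩ := h.cover.swap.exists_head_left
  obtain ⟨a, ha, hab, -⟩ := h.cover.exists_notMem hG b b b
  obtain ⟨P₁, P₂, hP⟩ := hzw
  obtain rfl : P₁ ++ z :: w :: P₂ = P := by simpa using hP
  have hP₁ : P₁ ≠ [] := by
    rintro rfl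
    exact h.headP z rfl hz
  have hx' : (P₁ ++ z :: Q).head? = some x := by
    cases P₁ with
    | nil => simp at hP₁
    | cons _ _ => simpa using hx
  have hyz : (G a).Adj y z := (h.adjQ a ha y hy z (by simp)).2 hz
  have hrev : TwoPathCover G u v ((P₂.reverse ++ [w]) ++ z :: P₁.reverse) Q C := by
    simpa using h.cover.rev
  obtain ⟨C', h', hC'⟩ := hrev.connect (by simp) hy ha hyz
  have hb' := hC' b hb hab.symm
  have h' : TwoPathCover G u v (w :: P₂) (P₁ ++ z :: Q) C' := by simpa using h'.rev
  have alt : ∀ p q, [p, q] <:+: P₁ ++ z :: Q → (f p ↔ ¬ f q) := by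
    intro p q hpq
    rcases List.pair_infix_append_cons hpq with hpq | hpq
    · exact h.altP p q (hpq.trans ⟨[], w :: P₂, by simp⟩)
    · rcases List.infix_cons_iff.1 hpq with ⟨t, ht⟩ | hpq
      · simp only [List.cons_append, List.nil_append, List.cons.injEq] at ht
        obtain ⟨rfl, ht⟩ := ht
        have : ¬ f q := h.headQ q (by rw [← ht]; rfl)
        tauto
      · exact h.altQ p q hpq
  have hmem : ∀ t, t ∈ w :: P₂ ++ (P₁ ++ z :: Q) → t ∈ P₁ ++ z :: w :: P₂ ++ Q := fun t ht =>
    (h.cover.mem t).2 ((h'.mem t).1 ht)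
  rcases List.mem_append.1 ((h'.mem w').2 ((h.cover.mem w').1 hw')) with hwP' | hwQ'
  · rcases List.head?_eq_or_exists_pair_infix hwP' with hw₀ | ⟨p, hp⟩
    · obtain rfl : w = w' := by simpa using hw₀
      simp [hw]
    · rw [h'.adj_iff hG hb' hb' rfl hx' hp,
        h.adjP b hb x hx p (hmem p (List.mem_append_left _ (List.mem_of_pair_infix_left hp))),
        h.altP p w' (hp.trans ⟨P₁ ++ [z], [], by simp⟩), not_not]
  · rcases List.getLast?_eq_or_exists_pair_infix hwQ' with hw₀ | ⟨q, hq⟩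
    · have h₁ := h'.swap.not_adj_last hG hb' hw₀ rfl
      have h₂ : ¬ f w' := by
        obtain ⟨Q', t, rfl⟩ : ∃ l t, Q = l ++ [t] := by
          rcases Q.eq_nil_or_concat' with rfl | h
          · simp at hy
          · simpa using h
        refine h.lastQ w' ?_
        rw [← hw₀]
        simp [List.getLast?_append, List.getLast?_cons]
      tauto
    · have e₁ := h'.swap.adj_iff hG hb' hb' hx' rfl hq
      rw [h.adjP b hb x hx q (hmem q (List.mem_append_right _ (List.mem_of_pair_infix_right hq)))]
        at e₁
      have e₂ := alt _ _ hq
      tauto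

theorem adj_iff {b : ι} {w w' : V} (h : AlternatingCover G u v P Q C f)
    (hG : IsCritical G u v) (hb : b ∉ C) (hwP : w ∈ P ++ Q) (hw : ¬ f w) (hw' : w' ∈ P ++ Q) :
    (G b).Adj w w' ↔ f w' := by
  rcases List.mem_append.1 hwP with hwP | hwQ
  · exact h.adj_iff_of_mem_left hG hb hwP hw hw'
  · exact h.swap.adj_iff_of_mem_left hG hb hwQ hw (by rw [List.mem_append] at *; exact hw'.symm)

/-- The conclusion of `adj_iff` holds in all colors, since every edge of the two paths may be
recolored by an unused color. -/
theorem adj_iff_all {c : ι} {w w' : V} (h : AlternatingCover G u v P Q C f)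
    (hG : IsCritical G u v) (hwP : w ∈ P ++ Q) (hw : ¬ f w) (hw' : w' ∈ P ++ Q) :
    (G c).Adj w w' ↔ f w' := by
  by_cases hc : c ∈ C
  swap
  · exact h.adj_iff hG hc hwP hw hw'
  obtain ⟨P', Q', hPQ, hcov, P₁, p, q, P₂, C₁, C₂, D, rfl, hC, h₁, h₂, hQ⟩ :=
    h.cover.exists_edge_of_mem hc
  have h' : AlternatingCover G u v (P₁ ++ p :: q :: P₂) Q' C f := by
    rcases hPQ with ⟨rfl, rfl⟩ | ⟨rfl, rfl⟩
    exacts [h, h.swap]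
  rw [h.cover.mem, ← h'.cover.mem] at hwP hw'
  obtain ⟨a, ha, -⟩ := hcov.exists_notMem hG c c c
  obtain ⟨b, hb, hba, -⟩ := hcov.exists_notMem hG a a a
  obtain ⟨y, hy⟩ := hcov.swap.exists_head_left
  have hfpq := h'.altP p q ⟨P₁, P₂, by simp⟩
  -- One of `p`, `q` lies outside `f`, and its neighborhood in the free color `a` is `f`.
  have hpq : (G a).Adj p q := by
    by_cases hp : f p
    · exact ((h'.adj_iff hG ha (w := q) (w' := p) (by simp) (hfpq.1 hp) (by simp)).2 hp).symm
    · exact (h'.adj_iff hG ha (w := p) (w' := q) (by simp) hp (by simp)).2 (by tauto)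
  have hnew := hcov.recolor hC h₁ h₂ hQ ha hpq
  have hc' : c ∉ a ::ₘ (C₁ + C₂ + D) := by
    have := hcov.colors
    rw [hC, Multiset.nodup_cons] at this
    rw [Multiset.mem_cons, not_or]
    exact ⟨fun hca => ha (hca ▸ hc), this.1⟩
  have hb' : b ∉ a ::ₘ (C₁ + C₂ + D) := by
    rw [hC, Multiset.mem_cons, not_or] at hb
    rw [Multiset.mem_cons, not_or]
    exact ⟨hba, hb.2⟩
  have hyf : ∀ t ∈ P₁ ++ p :: q :: P₂ ++ Q', (G b).Adj y t ↔ f t := h'.adjQ b hb y hy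
  obtain ⟨z, hz, hfz⟩ : ∃ z ∈ P₁ ++ p :: q :: P₂, f z := by
    by_cases hp : f p
    · exact ⟨p, by simp, hp⟩
    · exact ⟨q, by simp, by tauto⟩
  -- The recolored cover alternates with respect to the neighborhood of `y` in color `b`, free in
  -- both covers; by `hyf` this is again `f`.
  have halt := hnew.alternatingCover hG hb' hy hz ((hyf z (List.mem_append_left _ hz)).2 hfz)
  rw [halt.adj_iff hG hc' hwP (by rwa [hyf w hwP]) hw', hyf w' hw']

end AlternatingCover

end Alternating

/-- Pair the entries off from the end, which lies outside `f`; an unpaired first entry remains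
exactly when the list also starts outside `f`. -/
theorem List.countP_not_of_alternating {α : Type*} (f : α → Prop) [DecidablePred f] (l : List α)
    (a : α) (halt : ∀ p q, [p, q] <:+: a :: l → (f p ↔ ¬ f q))
    (hlast : ∀ z, (a :: l).getLast? = some z → ¬ f z) :
    (a :: l).countP (¬ f ·) = (a :: l).countP (f ·) + if f a then 0 else 1 := by
  induction l generalizing a with
  | nil =>
    have := hlast a rfl
    simp [this]
  | cons b l ih =>
    have h₁ := ih b (fun p q hpq => halt p q (hpq.trans (List.suffix_cons _ _).isInfix))
      (by simpa using hlast)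
    have h₂ := halt a b ⟨[], l, rfl⟩
    rw [List.countP_cons, List.countP_cons (a := a), h₁]
    by_cases ha : f a
    · have hb : ¬ f b := h₂.1 ha
      simp [ha, hb]
    · have hb : f b := by tauto
      simp [ha, hb]

/-- Each path has one more vertex outside `f` than inside. Of the `n - 2` covered vertices, exactly
`n/2` therefore lie outside, and vertices outside `f` are adjacent only to `f`. -/
theorem AlternatingCover.exists_independent {V ι : Type*} [Fintype V] [Fintype ι]
    {G : ι → SimpleGraph V} {u v : V} {P Q : List V} {C : Multiset ι}
    {f : V → Prop} (h : AlternatingCover G u v P Q C f) (hG : IsCritical G u v) :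
    ∃ Y : Finset V, 2 * Y.card = Fintype.card V ∧ 2 ≤ Y.card ∧ u ∉ Y ∧ v ∉ Y ∧
      ∀ i, ∀ x ∈ Y, ∀ y ∈ Y, ¬ (G i).Adj x y := by
  classical
  obtain ⟨x, hx⟩ := h.cover.exists_head_left
  obtain ⟨y, hy⟩ := h.cover.swap.exists_head_left
  have hcard := h.cover.card_add hG.ne
  obtain ⟨C₁, C₂, h₁, h₂, rfl⟩ := h.cover.exists_colors
  have hnd := h.cover.nodup
  have hY : ((P ++ Q).filter (¬ f ·)).toFinset.card = (P ++ Q).countP (¬ f ·) := by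
    rw [List.toFinset_card_of_nodup (hnd.filter _), List.countP_eq_length_filter]
  have cP : P.countP (¬ f ·) = P.countP (f ·) + 1 := by
    obtain ⟨P', rfl⟩ : ∃ P', P = x :: P' := by cases P <;> simp_all
    rw [List.countP_not_of_alternating f P' x h.altP h.lastP, if_neg (h.headP x rfl)]
  have cQ : Q.countP (¬ f ·) = Q.countP (f ·) + 1 := by
    obtain ⟨Q', rfl⟩ : ∃ Q', Q = y :: Q' := by cases Q <;> simp_all
    rw [List.countP_not_of_alternating f Q' y h.altQ h.lastQ, if_neg (h.headQ y rfl)]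
  have lP := List.length_eq_countP_add_countP (f ·) (l := P)
  have lQ := List.length_eq_countP_add_countP (f ·) (l := Q)
  have e₁ := h₁.card
  have e₂ := h₂.card
  simp only [decide_eq_true_eq] at lP lQ
  rw [Multiset.card_add] at hcard
  rw [List.countP_append] at hY
  refine ⟨((P ++ Q).filter (¬ f ·)).toFinset, by omega, by omega, ?_, ?_, ?_⟩
  · simp only [List.mem_toFinset, List.mem_filter, h.cover.mem]
    tauto
  · simp only [List.mem_toFinset, List.mem_filter, h.cover.mem]
    tauto
  · intro i s hs t ht
    simp only [List.mem_toFinset, List.mem_filter, decide_eq_true_eq] at hs ht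
    rw [h.adj_iff_all hG hs.1 hs.2 ht.1]
    exact ht.2

/-! ### Separated ends: no edges between the two paths -/

section Separated

variable {V ι : Type*} [Fintype V] [Fintype ι] {G : ι → SimpleGraph V} {u v : V} {P Q : List V}
  {C : Multiset ι}

/-- In no two-path cover is an end of one path joined to the other path in an unused color. -/
def EndsSeparated (G : ι → SimpleGraph V) (u v : V) : Prop :=
  ∀ (P Q : List V) (C : Multiset ι) (a : ι) (y z : V), TwoPathCover G u v P Q C → a ∉ C →
    Q.head? = some y → z ∈ P → ¬ (G a).Adj y z

namespace TwoPathCover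

/-- The head of `Q` is not joined to the predecessor of `t`, so the dichotomy forces `x ~ t`. The
displayed edge `pq` guarantees that such a predecessor exists. -/
theorem adj_head_last {P₁ P₂ : List V} {p q x t : V} {a : ι}
    (h : TwoPathCover G u v (P₁ ++ p :: q :: P₂) Q C) (hG : IsCritical G u v)
    (hsep : EndsSeparated G u v) (hx : (P₁ ++ [p]).head? = some x)
    (ht : (q :: P₂).getLast? = some t) (ha : a ∉ C) : (G a).Adj x t := by
  obtain ⟨y, hy⟩ := h.swap.exists_head_left
  have hx' : (P₁ ++ p :: q :: P₂).head? = some x := by cases P₁ <;> simpa using hx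
  obtain ⟨r, hr⟩ : ∃ r, [r, t] <:+: P₁ ++ p :: q :: P₂ := by
    rcases List.head?_eq_or_exists_pair_infix (List.mem_of_getLast? ht) with hq | ⟨r, hr⟩
    · obtain rfl : q = t := by simpa using hq
      exact ⟨p, P₁, P₂, by simp⟩
    · exact ⟨r, hr.trans ⟨P₁ ++ [p], [], by simp⟩⟩
  exact (h.adj_iff hG ha ha hx' hy hr).2
    (hsep _ _ _ _ _ _ h ha hy (List.mem_of_pair_infix_left hr))

/-- Close `P` to a cycle and cut it before `z`: then `z` is an end. The closing color `a` differs
from `b`, so `b` stays free. -/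
theorem not_adj_of_notMem {b : ι} {z w : V} (h : TwoPathCover G u v P Q C)
    (hG : IsCritical G u v) (hsep : EndsSeparated G u v) (hb : b ∉ C) (hz : z ∈ P) (hw : w ∈ Q) :
    ¬ (G b).Adj z w := by
  rcases List.head?_eq_or_exists_pair_infix hz with hz | ⟨p, P₁, P₂, hP⟩
  · exact hsep _ _ _ _ _ _ h.swap hb hz hw
  obtain rfl : P₁ ++ p :: z :: P₂ = P := by simpa using hP
  obtain ⟨a, ha, hab, -⟩ := h.exists_notMem hG b b b
  obtain ⟨x, hx⟩ : ∃ x, (P₁ ++ [p]).head? = some x := by cases P₁ <;> simp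
  obtain ⟨t, ht⟩ : ∃ t, (z :: P₂).getLast? = some t := ⟨_, List.getLast?_eq_some_getLast (by simp)⟩
  have hxt := h.adj_head_last hG hsep hx ht ha
  obtain ⟨C₁, C₂, h₁, h₂, rfl⟩ := h.exists_colors
  obtain ⟨c, D₁, D₂, rfl, -, hl, hr⟩ := h₁.split
  have hnew := h.rotate (Multiset.cons_add _ _ _) hl hr h₂ hx ht ha hxt
  refine hsep _ _ _ b z w hnew.swap ?_ rfl hw
  simp only [Multiset.cons_add, Multiset.mem_cons, not_or] at hb ⊢
  exact ⟨hab.symm, hb.2⟩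

/-- A used color `c` is released by closing its path to a cycle and cutting at the edge colored `c`;
the vertex sets of the two paths do not change. -/
theorem not_adj {c : ι} {z w : V} (h : TwoPathCover G u v P Q C)
    (hG : IsCritical G u v) (hsep : EndsSeparated G u v) (hz : z ∈ P) (hw : w ∈ Q) :
    ¬ (G c).Adj z w := by
  by_cases hc : c ∈ C
  swap
  · exact h.not_adj_of_notMem hG hsep hc hz hw
  obtain ⟨P', Q', hPQ, h', P₁, p, q, P₂, C₁, C₂, D, rfl, hC, h₁, h₂, hQ⟩ :=
    h.exists_edge_of_mem hc
  obtain ⟨a, ha, -⟩ := h'.exists_notMem hG c c c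
  obtain ⟨x, hx⟩ : ∃ x, (P₁ ++ [p]).head? = some x := by cases P₁ <;> simp
  obtain ⟨t, ht⟩ : ∃ t, (q :: P₂).getLast? = some t := ⟨_, List.getLast?_eq_some_getLast (by simp)⟩
  have hnew := h'.rotate hC h₁ h₂ hQ hx ht ha (h'.adj_head_last hG hsep hx ht ha)
  have hc' : c ∉ a ::ₘ (C₁ + C₂ + D) := by
    have := h.colors
    rw [hC, Multiset.nodup_cons] at this
    rw [Multiset.mem_cons, not_or]
    exact ⟨fun hca => ha (hca ▸ hc), this.1⟩
  have key : ∀ s ∈ P₁ ++ p :: q :: P₂, ∀ r ∈ Q', ¬ (G c).Adj s r := fun s hs r hr =>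
    hnew.not_adj_of_notMem hG hsep hc' (by
      simp only [List.mem_append, List.mem_cons, List.not_mem_nil] at hs ⊢
      tauto) hr
  rcases hPQ with ⟨rfl, rfl⟩ | ⟨rfl, rfl⟩
  · exact key z hz w hw
  · exact fun hzw => key w hw z hz hzw.symm

end TwoPathCover

end Separated

/-! ### Maximal collections without a rainbow Hamiltonian path -/

section Maximal

variable {V ι : Type*} {G : ι → SimpleGraph V} {u v : V}

/-- The path created by adding `xy` in color `i` must use this edge; deleting it leaves the two
pieces. The direction of traversal decides which of `x`, `y` is `p`. -/
theorem exists_splitPath_of_maximal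
    (hmax : Maximal (fun G => ¬ HasRainbowHamiltonianList G u v) G) {i : ι} {x y : V}
    (hxy : x ≠ y) (hadj : ¬ (G i).Adj x y) :
    ∃ p q L R C₁ C₂, (p = x ∧ q = y ∨ p = y ∧ q = x) ∧ SplitPath G u v p q L R C₁ C₂ ∧
      i ∉ C₁ + C₂ := by
  classical
  set G' : ι → SimpleGraph V := Function.update G i (G i ⊔ SimpleGraph.edge x y) with hG'
  have hle : G ≤ G' := by
    intro j
    rcases eq_or_ne j i with rfl | hj
    · simp [hG']
    · simp [hG', Function.update_of_ne hj]
  have hedge : (G' i).Adj x y := by simp [hG', SimpleGraph.edge_adj, hxy]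
  have hpath : HasRainbowHamiltonianList G' u v := by
    by_contra hN
    exact hadj (hmax.2 hN hle i hedge)
  obtain ⟨l, C, h, hC, hl, hz, hu, hv⟩ := hpath
  have hor : ∀ j a b, (G' j).Adj a b →
      (G j).Adj a b ∨ j = i ∧ (a = x ∧ b = y ∨ a = y ∧ b = x) := by
    intro j a b hab
    rcases eq_or_ne j i with rfl | hj
    · rw [hG', Function.update_self, SimpleGraph.sup_adj, SimpleGraph.edge_adj] at hab
      tauto
    · rw [hG', Function.update_of_ne hj] at hab
      exact .inl hab
  rcases h.of_adj_or hor hC with h | ⟨l₁, p, q, l₂, C₁, C₂, rfl, rfl, hpq, h₁, h₂⟩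
  · exact absurd ⟨l, C, h, hC, hl, hz, hu, hv⟩ hmax.1
  rw [Multiset.nodup_cons] at hC
  refine ⟨p, q, (l₁ ++ [p]).reverse, q :: l₂, C₁, C₂, hpq, ⟨h₁.reverse, h₂, hC.2, ?_, ?_, by simp,
    ?_, rfl, ?_⟩, hC.1⟩
  · refine ((List.reverse_perm (l₁ ++ [p])).append_right _).nodup_iff.2 ?_
    simpa using hl
  · intro z
    have := hz z
    simp only [List.mem_append, List.mem_cons, List.mem_reverse, List.not_mem_nil] at this ⊢
    tauto
  · rw [List.getLast?_reverse]
    cases l₁ <;> simpa using hu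
  · simpa [List.getLast?_append, List.getLast?_cons] using hv

variable [Fintype V] [Fintype ι]

/-- For a missing pair containing `u` or `v`, the edges `pv` and `qu` supplied by the dichotomy
include either a loop or the missing pair itself. -/
theorem isCritical_of_maximal
    (hmax : Maximal (fun G => ¬ HasRainbowHamiltonianList G u v) G)
    (hO : ∀ i, OreCondition (G i)) (hcard : Fintype.card ι = Fintype.card V) (huv : u ≠ v) :
    IsCritical G u v := by
  have key : ∀ i x y, x ≠ y → ¬ (G i).Adj x y → ∃ p q, (p = x ∧ q = y ∨ p = y ∧ q = x) ∧
      (G i).Adj p v ∧ (G i).Adj q u := by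
    intro i x y hxy hadj
    obtain ⟨p, q, L, R, C₁, C₂, hpq, h, hi⟩ := exists_splitPath_of_maximal hmax hxy hadj
    have h₁ := h.left.card
    have h₂ := h.right.card
    have h₃ := h.length_add_length
    -- The two pieces have `n - 2` edges, so a second color besides `i` is unused.
    obtain ⟨s, hs⟩ := exists_color_notMem (i ::ₘ (C₁ + C₂)) (by
      simp only [Multiset.card_cons, Multiset.card_add]
      omega)
    rw [Multiset.mem_cons, not_or] at hs
    obtain ⟨hpv, hqu, -⟩ := h.adj_dichotomy hO hmax.1 hi hs.2 (Ne.symm hs.1)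
    exact ⟨p, q, hpq, hpv, hqu⟩
  refine ⟨hO, hmax.1, ?_, ?_, hcard, huv⟩
  · intro i w hw
    by_contra hadj
    obtain ⟨p, q, ⟨rfl, rfl⟩ | ⟨rfl, rfl⟩, h₁, h₂⟩ := key i w u hw hadj
    exacts [h₂.ne rfl, hadj h₂]
  · intro i w hw
    by_contra hadj
    obtain ⟨p, q, ⟨rfl, rfl⟩ | ⟨rfl, rfl⟩, h₁, h₂⟩ := key i w v hw hadj
    exacts [hadj h₁, h₁.ne rfl]

theorem HasRainbowHamiltonianList.of_complete (hG : ∀ i x y, x ≠ y → (G i).Adj x y)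
    (hcard : Fintype.card ι = Fintype.card V) (huv : u ≠ v) : HasRainbowHamiltonianList G u v := by
  classical
  set l : List V := u :: ((Finset.univ \ {u, v}).toList ++ [v]) with hl
  have hnd : l.Nodup := by
    rw [hl, List.nodup_cons, List.nodup_append]
    refine ⟨by simp [huv], Finset.nodup_toList _, by simp, ?_⟩
    intro a ha b hb
    simp at ha hb
    rintro rfl
    exact ha.2 hb
  have hmem : ∀ z, z ∈ l := by
    intro z
    simp only [hl, List.mem_cons, List.mem_append, Finset.mem_toList, Finset.mem_sdiff,
      Finset.mem_univ, Finset.mem_insert, Finset.mem_singleton, List.not_mem_nil]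
    tauto
  have hlen : l.length = Fintype.card V := by
    rw [← List.toFinset_card_of_nodup hnd, ← Finset.card_univ]
    congr 1
    ext z
    simpa using hmem z
  have hpos : 0 < l.length := by simp [hl]
  obtain ⟨s, -, hs⟩ := Finset.exists_subset_card_eq
    (show l.length - 1 ≤ (Finset.univ : Finset ι).card by rw [Finset.card_univ]; omega)
  refine ⟨l, s.val, .of_complete hG hnd ?_, s.nodup, hnd, hmem, rfl, ?_⟩
  · rw [Finset.card_val]
    omega
  · simp [hl, List.getLast?_cons]

/-- Some edge is missing, as complete graphs have the path. The resulting pieces lose their final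
vertices `u` and `v`; neither becomes empty, because `p ≠ u` and `q ≠ v` when `u` and `v` miss no
edge. -/
theorem IsCritical.exists_twoPathCover
    (hmax : Maximal (fun G => ¬ HasRainbowHamiltonianList G u v) G) (hG : IsCritical G u v) :
    ∃ P Q C, TwoPathCover G u v P Q C := by
  obtain ⟨i, x, y, hxy, hadj⟩ : ∃ i x y, x ≠ y ∧ ¬ (G i).Adj x y := by
    by_contra! h
    exact hG.noPath (.of_complete h hG.card hG.ne)
  obtain ⟨p, q, L, R, C₁, C₂, hpq, h, hi⟩ := exists_splitPath_of_maximal hmax hxy hadj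
  have hpq' : p ≠ q ∧ ¬ (G i).Adj p q := by
    rcases hpq with ⟨rfl, rfl⟩ | ⟨rfl, rfl⟩
    exacts [⟨hxy, hadj⟩, ⟨hxy.symm, fun h => hadj h.symm⟩]
  have hpu : p ≠ u := by
    rintro rfl
    exact hpq'.2 (hG.adj_left i q hpq'.1.symm).symm
  have hqv : q ≠ v := by
    rintro rfl
    exact hpq'.2 (hG.adj_right i p hpq'.1)
  have key : ∀ {L : List V} {s t : V} {C : Multiset ι}, RainbowList G L C → L.head? = some s →
      L.getLast? = some t → s ≠ t → ∃ P D, L = P ++ [t] ∧ RainbowList G P D ∧ D ≤ C := by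
    intro L s t C hL hs ht hst
    obtain ⟨P, rfl⟩ : ∃ P, L = P ++ [t] := by
      rcases L.eq_nil_or_concat' with rfl | ⟨P, t', rfl⟩
      · simp at hs
      · obtain rfl : t' = t := by simpa using ht
        exact ⟨P, rfl⟩
    rcases P.eq_nil_or_concat' with rfl | ⟨P, r, rfl⟩
    · exact absurd (by simpa using hs) hst.symm
    · rw [List.append_assoc] at hL
      obtain ⟨c, D₁, D₂, rfl, -, hD, -⟩ := RainbowList.split hL
      exact ⟨_, D₁, rfl, hD, (Multiset.le_add_right _ _).trans (Multiset.le_cons_self _ _)⟩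
  obtain ⟨P, D₁, rfl, hP, hD₁⟩ := key h.left h.headL h.lastL hpu
  obtain ⟨Q, D₂, rfl, hQ, hD₂⟩ := key h.right h.headR h.lastR hqv
  have hperm : (P ++ [u] ++ (Q ++ [v])).Perm (u :: v :: (P ++ Q)) := by
    classical
    refine List.perm_iff_count.2 fun w => ?_
    simp only [List.count_append, List.count_cons, List.count_nil]
    omega
  have hnd := hperm.nodup h.nodup
  simp only [List.nodup_cons, List.mem_cons, not_or] at hnd
  refine ⟨P, Q, D₁ + D₂, ⟨_, _, hP, hQ, rfl⟩,
    Multiset.nodup_of_le (add_le_add hD₁ hD₂) h.colors, hnd.2.2, fun z => ⟨?_, ?_⟩⟩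
  · intro hz
    exact ⟨fun h => hnd.1.2 (h ▸ hz), fun h => hnd.2.1 (h ▸ hz)⟩
  · intro hz
    have := hperm.subset (h.mem z)
    simp only [List.mem_cons] at this
    tauto

/-- A collection of Ore graphs that is maximal without rainbow Hamiltonian `u,v`-path either has
all its graphs separated by `{u, v}` in the same way, or has a common independent set
of half the vertices. -/
theorem exists_separation_or_independent
    (hmax : Maximal (fun G => ¬ HasRainbowHamiltonianList G u v) G)
    (hO : ∀ i, OreCondition (G i)) (hcard : Fintype.card ι = Fintype.card V) (huv : u ≠ v) :
    (∃ P Q : List V, P ≠ [] ∧ Q ≠ [] ∧ P.Disjoint Q ∧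
      (∀ z, z ∈ P ++ Q ↔ z ≠ u ∧ z ≠ v) ∧ ∀ i, ∀ x ∈ P, ∀ y ∈ Q, ¬ (G i).Adj x y) ∨
    ∃ Y : Finset V, 2 * Y.card = Fintype.card V ∧ 2 ≤ Y.card ∧ u ∉ Y ∧ v ∉ Y ∧
      ∀ i, ∀ x ∈ Y, ∀ y ∈ Y, ¬ (G i).Adj x y := by
  have hG := isCritical_of_maximal hmax hO hcard huv
  by_cases hsep : EndsSeparated G u v
  · left
    obtain ⟨P, Q, C, h⟩ := hG.exists_twoPathCover hmax
    obtain ⟨C₁, C₂, h₁, h₂, -⟩ := h.exists_colors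
    exact ⟨P, Q, h₁.ne_nil, h₂.ne_nil, List.disjoint_of_nodup_append h.nodup, h.mem,
      fun i x hx y hy => h.not_adj hG hsep hx hy⟩
  · right
    simp only [EndsSeparated, not_forall, not_not] at hsep
    obtain ⟨P, Q, C, a, y, z, h, ha, hy, hz, hyz⟩ := hsep
    exact (h.alternatingCover hG ha hy hz hyz).exists_independent hG

end Maximal

/-! ### Ore's condition in the original graphs -/

theorem SimpleGraph.degreeSum_eq_degree {V : Type*} [Fintype V] (H : SimpleGraph V)
    [DecidableRel H.Adj] (x : V) : H.degreeSum x = H.degree x := by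
  classical
  rw [SimpleGraph.degreeSum, ← SimpleGraph.card_neighborFinset_eq_degree,
    SimpleGraph.neighborFinset_eq_filter, Finset.card_filter]
  exact Finset.sum_congr rfl fun _ _ => by congr

theorem SimpleGraph.degreeSum_mono {V : Type*} [Fintype V] {H K : SimpleGraph V} (h : H ≤ K)
    (x : V) : H.degreeSum x ≤ K.degreeSum x := by
  classical
  refine Finset.sum_le_sum fun z _ => ?_
  split_ifs with h₁ h₂
  exacts [le_rfl, absurd (h h₁) h₂, zero_le_one, le_rfl]

theorem OreCondition.mono {V : Type*} [Fintype V] {H K : SimpleGraph V} (hH : OreCondition H)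
    (h : H ≤ K) : OreCondition K := fun x y hxy hadj =>
  (hH x y hxy fun hxy => hadj (h hxy)).trans
    (add_le_add (SimpleGraph.degreeSum_mono h x) (SimpleGraph.degreeSum_mono h y))

theorem SimpleGraph.le_degree_add_degree_of_le_sigmaTwo {V : Type*} [Fintype V]
    {H : SimpleGraph V} [DecidableRel H.Adj] {n : ℕ} (h : (n : ℕ∞) ≤ H.sigmaTwo) {x y : V}
    (hxy : x ≠ y) (hadj : ¬ H.Adj x y) : n ≤ H.degree x + H.degree y := by
  have := h.trans ((iInf_le _ x).trans ((iInf_le _ y).trans (iInf_le _ ⟨hxy, hadj⟩)))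
  exact_mod_cast this

/-- If `{u, v}` separates `X` from `Y` then the Ore condition forces `X ∪ {u, v}` and
`Y ∪ {u, v}` to be complete except possibly for the pair `uv`. -/
theorem SimpleGraph.adj_of_separation {V : Type*} [Fintype V] [DecidableEq V]
    {H : SimpleGraph V} [DecidableRel H.Adj]
    (hO : ∀ x y, x ≠ y → ¬ H.Adj x y → Fintype.card V ≤ H.degree x + H.degree y)
    {u v : V} (huv : u ≠ v) {X Y : Finset V} (hdisj : Disjoint X Y)
    (hXY : X ∪ Y = Finset.univ \ {u, v}) (hY : Y.Nonempty)
    (hsep : ∀ x ∈ X, ∀ y ∈ Y, ¬ H.Adj x y) {x w : V} (hx : x ∈ X)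
    (hw : w ∈ insert u (insert v X)) (hxw : x ≠ w) : H.Adj x w := by
  obtain ⟨y, hy⟩ := hY
  have hmem : ∀ z, z ∈ X ∨ z ∈ Y ↔ z ≠ u ∧ z ≠ v := fun z => by
    rw [← Finset.mem_union, hXY]
    simp
  have hu : ¬ (u ∈ X ∨ u ∈ Y) := fun h => ((hmem u).1 h).1 rfl
  have hv : ¬ (v ∈ X ∨ v ∈ Y) := fun h => ((hmem v).1 h).2 rfl
  have hsum : X.card + Y.card + 2 = Fintype.card V := by
    rw [← Finset.card_union_of_disjoint hdisj, hXY, ← Finset.card_pair huv,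
      Finset.card_sdiff_add_card_eq_card (Finset.subset_univ _), Finset.card_univ]
  have key : ∀ {Z : Finset V}, u ∉ Z → v ∉ Z → ∀ z ∈ Z,
      ((insert u (insert v Z)).erase z).card = Z.card + 1 := by
    intro Z hu hv z hz
    rw [Finset.card_erase_of_mem (by simp [hz]), Finset.card_insert_of_notMem (by simp [huv, hu]),
      Finset.card_insert_of_notMem hv]
    omega
  have sX : H.neighborFinset x ⊆ (insert u (insert v X)).erase x := by
    intro z hz
    rw [SimpleGraph.mem_neighborFinset] at hz
    have h₁ := hsep x hx z
    have h₂ := hmem z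
    have h₃ := hz.ne'
    simp only [Finset.mem_erase, Finset.mem_insert]
    tauto
  have sY : H.neighborFinset y ⊆ (insert u (insert v Y)).erase y := by
    intro z hz
    rw [SimpleGraph.mem_neighborFinset] at hz
    have h₁ := fun h => hsep z h y hy hz.symm
    have h₂ := hmem z
    have h₃ := hz.ne'
    simp only [Finset.mem_erase, Finset.mem_insert]
    tauto
  have cX := key (fun h => hu (.inl h)) (fun h => hv (.inl h)) x hx
  have cY := key (fun h => hu (.inr h)) (fun h => hv (.inr h)) y hy
  have hY' := Finset.card_le_card sY
  have hdeg := hO x y (Finset.disjoint_iff_ne.1 hdisj x hx y hy) (hsep x hx y hy)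
  -- The degree of `x` is at most `|X| + 1` and that of `y` at most `|Y| + 1`; these bounds sum to
  -- `n`, so both are attained.
  have hle : ((insert u (insert v X)).erase x).card ≤ (H.neighborFinset x).card := by
    rw [SimpleGraph.card_neighborFinset_eq_degree] at hY' ⊢
    omega
  rw [← SimpleGraph.mem_neighborFinset, Finset.eq_of_subset_of_card_le sX hle, Finset.mem_erase]
  exact ⟨hxw.symm, hw⟩

/-- An independent set of half the vertices is completely joined to its complement by the
Ore condition. -/
theorem SimpleGraph.adj_of_independent {V : Type*} [Fintype V] [DecidableEq V]
    {H : SimpleGraph V} [DecidableRel H.Adj]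
    (hO : ∀ x y, x ≠ y → ¬ H.Adj x y → Fintype.card V ≤ H.degree x + H.degree y)
    {Y : Finset V} (hY : 2 * Y.card = Fintype.card V) (hY₂ : 2 ≤ Y.card)
    (hind : ∀ x ∈ Y, ∀ y ∈ Y, ¬ H.Adj x y) {y w : V} (hy : y ∈ Y) (hw : w ∉ Y) : H.Adj y w := by
  -- A second vertex of `Y` is needed to apply Ore's condition; both degrees are at most `n/2`,
  -- hence equal to it.
  obtain ⟨z, hz, hzy⟩ := Finset.exists_mem_ne (by omega : 1 < Y.card) y
  have sub : ∀ t ∈ Y, H.neighborFinset t ⊆ Yᶜ := by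
    intro t ht s hs
    rw [SimpleGraph.mem_neighborFinset] at hs
    exact Finset.mem_compl.2 fun h => hind t ht s h hs
  have hc := Finset.card_compl Y
  have h₁ := Finset.card_le_card (sub z hz)
  have hdeg := hO y z hzy.symm (hind y hy z hz)
  have hle : Yᶜ.card ≤ (H.neighborFinset y).card := by
    rw [SimpleGraph.card_neighborFinset_eq_degree] at h₁ ⊢
    omega
  rw [← SimpleGraph.mem_neighborFinset, Finset.eq_of_subset_of_card_le (sub y hy) hle,
    Finset.mem_compl]
  exact hw

theorem theorem1p4 {V : Type*} [Fintype V] [DecidableEq V] (n : ℕ) (hn : Fintype.card V = n)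
    (G : Fin n → SimpleGraph V) [∀ i, DecidableRel (G i).Adj]
    (hG : ∀ i, (n : ℕ∞) ≤ (G i).sigmaTwo) (u v : V) (huv : u ≠ v) :
    HasRainbowHamiltonianPath G u v ∨
    (∃ X Y : Finset V, Disjoint X Y ∧ X ∪ Y = Finset.univ \ {u, v} ∧ 1 ≤ X.card ∧ 1 ≤ Y.card ∧
      ∀ i, (G i).IsClique (X : Set V) ∧ (G i).IsClique (Y : Set V) ∧
        (∀ x ∈ X, ∀ y ∈ Y, ¬ (G i).Adj x y) ∧
        ∀ w ∈ X ∪ Y, (G i).Adj u w ∧ (G i).Adj v w) ∨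
    (Even n ∧ ∃ X Y : Finset V, Disjoint X Y ∧ X ∪ Y = Finset.univ ∧
      X.card = n / 2 ∧ Y.card = n / 2 ∧ u ∈ X ∧ v ∈ X ∧
      ∀ i, (G i).IsCompleteBetween (X : Set V) (Y : Set V)) := by
  subst hn
  have hO : ∀ i x y, x ≠ y → ¬ (G i).Adj x y →
      Fintype.card V ≤ (G i).degree x + (G i).degree y := fun i x y hxy hadj =>
    SimpleGraph.le_degree_add_degree_of_le_sigmaTwo (hG i) hxy hadj
  have hO' : ∀ i, OreCondition (G i) := fun i x y hxy hadj => by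
    rw [SimpleGraph.degreeSum_eq_degree, SimpleGraph.degreeSum_eq_degree]
    exact hO i x y hxy hadj
  by_cases hN : HasRainbowHamiltonianList G u v
  · have : Nonempty (Fin (Fintype.card V)) := ⟨⟨0, Fintype.card_pos_iff.2 ⟨u⟩⟩⟩
    exact .inl hN.hasRainbowHamiltonianPath
  right
  -- Only non-edges are taken from `G'`; adjacencies are rederived from Ore's condition in `G`.
  obtain ⟨G', hle, hmax⟩ := (Set.toFinite
    {G : Fin (Fintype.card V) → SimpleGraph V |
      ¬ HasRainbowHamiltonianList G u v}).exists_le_maximal (a := G) hN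
  rcases exists_separation_or_independent hmax (fun i => (hO' i).mono (hle i)) (by simp) huv with
    ⟨P, Q, hP, hQ, hdisj, hmem, hsep⟩ | ⟨Y, hY, hY₂, hu, hv, hind⟩
  · left
    have hXY : P.toFinset ∪ Q.toFinset = Finset.univ \ {u, v} := by
      ext z
      simpa using hmem z
    have hd : Disjoint P.toFinset Q.toFinset := by
      rw [Finset.disjoint_left]
      intro z hz hz'
      exact hdisj (List.mem_toFinset.1 hz) (List.mem_toFinset.1 hz')
    have hX : P.toFinset.Nonempty := List.toFinset_nonempty_iff _ |>.2 hP
    have hY : Q.toFinset.Nonempty := List.toFinset_nonempty_iff _ |>.2 hQ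
    have hs : ∀ i, ∀ x ∈ P.toFinset, ∀ y ∈ Q.toFinset, ¬ (G i).Adj x y :=
      fun i x hx y hy hxy => hsep i x (List.mem_toFinset.1 hx) y (List.mem_toFinset.1 hy)
        (hle i hxy)
    have aX : ∀ i, ∀ x ∈ P.toFinset, ∀ w ∈ insert u (insert v P.toFinset), x ≠ w →
        (G i).Adj x w := fun i x hx w hw hxw =>
      SimpleGraph.adj_of_separation (hO i) huv hd hXY hY (hs i) hx hw hxw
    have aY : ∀ i, ∀ x ∈ Q.toFinset, ∀ w ∈ insert u (insert v Q.toFinset), x ≠ w →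
        (G i).Adj x w := fun i x hx w hw hxw =>
      SimpleGraph.adj_of_separation (hO i) huv hd.symm (by rw [Finset.union_comm, hXY]) hX
        (fun x hx y hy hxy => hs i y hy x hx hxy.symm) hx hw hxw
    refine ⟨P.toFinset, Q.toFinset, hd, hXY, hX.card_pos, hY.card_pos, fun i => ⟨?_, ?_, hs i, ?_⟩⟩
    · intro x hx w hw hxw
      exact aX i x hx w (by simp at hw ⊢; tauto) hxw
    · intro x hx w hw hxw
      exact aY i x hx w (by simp at hw ⊢; tauto) hxw
    · intro w hw
      have hne : w ≠ u ∧ w ≠ v := (hmem w).1 (by simpa using hw)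
      rcases Finset.mem_union.1 hw with hw | hw
      · exact ⟨(aX i w hw u (by simp) hne.1).symm, (aX i w hw v (by simp) hne.2).symm⟩
      · exact ⟨(aY i w hw u (by simp) hne.1).symm, (aY i w hw v (by simp) hne.2).symm⟩
  · right
    have hc := Finset.card_compl Y
    refine ⟨⟨Y.card, by omega⟩, Yᶜ, Y, disjoint_compl_left,
      by rw [Finset.union_comm, Finset.union_compl], by omega, by omega,
      Finset.mem_compl.2 hu, Finset.mem_compl.2 hv, fun i x hx y hy => ?_⟩
    exact (SimpleGraph.adj_of_independent (hO i) hY hY₂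
      (fun x hx y hy hxy => hind i x hx y hy (hle i hxy)) hy
      (Finset.mem_compl.1 hx)).symm
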